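/- Let $n\ge 2$ and consider a line of $n$ qubits. For $A,B\in U(2)$ with $\det A=\det B$, the matchgate $G(A,B)\in U(4)$ acts as $A$ on $\mathrm{span}\{|00\rangle,|11\rangle\}$ and as $B$ on $\mathrm{span}\{|01\rangle,|10\rangle\}$ (in these ordered bases). A nearest-neighbour matchgate is a $G(A,B)$ acting on qubits $k,k+1$ for some $1\le k<n$; it is called normalised if $\det A=\det B=1$ for some such description. Let $G\subset U(2^n)$ be the matchgate group, that is, the group generated by all nearest-neighbour matchgates, and let $G_1\subset G$ be the group generated by the normalised ones. For $1\le k\le n$ let $c_{2k-1}=Z_1\cdots Z_{k-1}X_k$ and $c_{2k}=Z_1\cdots Z_{k-1}Y_k$ be the $2n$ Jordan–Wigner Majorana operators. A unitary $U\in U(2^n)$ acts on them as a proper rotation if there is $R\in SO(2n)$ with $Uc_\ell U^\dagger=\sum_{m}R_{\ell m}c_m$ for all $\ell$. 1. Every $U\in G$ acts on the Majorana operators as a proper rotation. 2. Conversely, every $U\in U(2^n)$ that acts on the Majorana operators as a proper rotation lies in $G$ and is a product of at most $2n^3$ (in particular, fewer than $4n^3$) nearest-neighbour matchgates. Moreover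 such a $U$ equals $zV$ with $z\in\mathbb C$, $|z|=1$, and $V\in G_1$ a product of at most $2n^3$ normalised nearest-neighbour matchgates; and every element of $G_1$ is itself a product of at most $2n^3$ normalised nearest-neighbour matchgates. 3. The scalar matrices in $G_1$ are exactly $\pm 1$. Modulo global phases, both groups are isomorphic to $SO(2n)$ as topological groups: for $H=G$ and for $H=G_1$, there is an isomorphism of topological groups from the quotient of $H$ by the scalar matrices it contains onto $SO(2n)$, sending the class of $U$ to the transpose $R^{T}$ of a matrix $R$ with $Uc_\ell U^\dagger=\sum_m R_{\ell m}c_m$ for all $\ell$. In particular $G_1/\{\pm1\}\cong SO(2n)$. Both $G$ and $G_1$ are compact. -/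

import Mathlib

namespace Matchgate

/-- Operators on `n` qubits, as matrices in the computational basis; a basis state is a bit string
`x : Fin n → Fin 2`. -/
abbrev Op (n : ℕ) : Type := Matrix (Fin n → Fin 2) (Fin n → Fin 2) ℂ

/-- The group `U(2ⁿ)` of unitaries on `n` qubits. -/
abbrev QubitUnitary (n : ℕ) : Type := Matrix.unitaryGroup (Fin n → Fin 2) ℂ

def pauliX : Matrix (Fin 2) (Fin 2) ℂ := !![0, 1; 1, 0]

def pauliY : Matrix (Fin 2) (Fin 2) ℂ := !![0, -Complex.I; Complex.I, 0]

def pauliZ : Matrix (Fin 2) (Fin 2) ℂ := !![1, 0; 0, -1]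

/-- The tensor product `P₀ ⊗ ⋯ ⊗ Pₙ₋₁` of one-qubit operators. -/
def tensorOp {n : ℕ} (P : Fin n → Matrix (Fin 2) (Fin 2) ℂ) : Op n :=
  Matrix.of fun x y => ∏ j, P j (x j) (y j)

/-- The Jordan–Wigner Majorana operators, indexed from `0`: with qubits numbered from `0` too,
`majorana (2k) = Z₀ ⋯ Zₖ₋₁ Xₖ` and `majorana (2k+1) = Z₀ ⋯ Zₖ₋₁ Yₖ`. -/
def majorana {n : ℕ} (m : Fin (2 * n)) : Op n :=
  tensorOp fun j =>
    if (j : ℕ) < (m : ℕ) / 2 then pauliZ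
    else if (j : ℕ) = (m : ℕ) / 2 then (if (m : ℕ) % 2 = 0 then pauliX else pauliY)
    else 1

/-- The two-qubit matrix `G(A, B)` in the basis `|00⟩, |01⟩, |10⟩, |11⟩`. -/
def gateMatrix (A B : Matrix (Fin 2) (Fin 2) ℂ) : Matrix (Fin 4) (Fin 4) ℂ :=
  !![A 0 0, 0, 0, A 0 1;
     0, B 0 0, B 0 1, 0;
     0, B 1 0, B 1 1, 0;
     A 1 0, 0, 0, A 1 1]

/-- Position of `|ab⟩` in the list `|00⟩, |01⟩, |10⟩, |11⟩`, that is `2 a + b`. -/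
def pairIndex (a b : Fin 2) : Fin 4 := ⟨2 * (a : ℕ) + (b : ℕ), by omega⟩

/-- The two-qubit operator `M` acting on the qubits `i`, `j` (in this order), the identity acting
on the remaining qubits. -/
def onPair {n : ℕ} (i j : Fin n) (M : Matrix (Fin 4) (Fin 4) ℂ) : Op n :=
  Matrix.of fun x y =>
    if ∀ k, k ≠ i → k ≠ j → x k = y k then M (pairIndex (x i) (x j)) (pairIndex (y i) (y j)) else 0

/-- Nearest-neighbour matchgates on a line of `n` qubits: `G(A, B)` with `A, B ∈ U(2)` and
`det A = det B`, on two consecutive qubits. -/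
def nnMatchgates (n : ℕ) : Set (QubitUnitary n) :=
  {U | ∃ i j : Fin n, (j : ℕ) = (i : ℕ) + 1 ∧
    ∃ A ∈ Matrix.unitaryGroup (Fin 2) ℂ, ∃ B ∈ Matrix.unitaryGroup (Fin 2) ℂ,
      A.det = B.det ∧ (U : Op n) = onPair i j (gateMatrix A B)}

/-- Nearest-neighbour matchgates with the phase normalised by `det A = det B = 1`. -/
def nnSpecialMatchgates (n : ℕ) : Set (QubitUnitary n) :=
  {U | ∃ i j : Fin n, (j : ℕ) = (i : ℕ) + 1 ∧
    ∃ A ∈ Matrix.unitaryGroup (Fin 2) ℂ, ∃ B ∈ Matrix.unitaryGroup (Fin 2) ℂ,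
      A.det = 1 ∧ B.det = 1 ∧ (U : Op n) = onPair i j (gateMatrix A B)}

/-- The group generated by all nearest-neighbour matchgates. -/
def matchgateGroup (n : ℕ) : Subgroup (QubitUnitary n) := Subgroup.closure (nnMatchgates n)

/-- The group generated by the nearest-neighbour matchgates with `det A = det B = 1`. -/
def specialMatchgateGroup (n : ℕ) : Subgroup (QubitUnitary n) :=
  Subgroup.closure (nnSpecialMatchgates n)

/-- `U c_ℓ U† = ∑ₘ R_{ℓm} c_m` for every Majorana operator `c_ℓ`. -/
def ActsBy {n : ℕ} (U : QubitUnitary n) (R : Matrix (Fin (2 * n)) (Fin (2 * n)) ℝ) : Prop :=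
  ∀ l, (U : Op n) * majorana l * (U : Op n).conjTranspose = ∑ m, (R l m : ℂ) • majorana m

/-- `U` acts on the Majorana operators as a proper rotation `R ∈ SO(2n)`. -/
def ActsAsProperRotation {n : ℕ} (U : QubitUnitary n) : Prop :=
  ∃ R ∈ Matrix.specialOrthogonalGroup (Fin (2 * n)) ℝ, ActsBy U R

/-- `U` is a product of at most `N` gates taken from `S`. -/
def IsProductOfAtMost {n : ℕ} (S : Set (QubitUnitary n)) (N : ℕ) (U : QubitUnitary n) : Prop :=
  ∃ L : List (QubitUnitary n), (∀ g ∈ L, g ∈ S) ∧ L.length ≤ N ∧ L.prod = U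

/-- The global phases: the scalar unitaries `z • 1`. -/
def phases (n : ℕ) : Subgroup (QubitUnitary n) where
  carrier := {U | ∃ z : ℂ, (U : Op n) = z • (1 : Op n)}
  one_mem' := ⟨1, by simp⟩
  mul_mem' := by
    rintro U V ⟨z, hz⟩ ⟨w, hw⟩
    exact ⟨z * w, by simp [hz, hw, smul_smul, mul_comm]⟩
  inv_mem' := by
    rintro U ⟨z, hz⟩
    exact ⟨star z, by
      rw [Matrix.UnitaryGroup.inv_val, hz, star_smul, star_one]⟩

instance phases_normal (n : ℕ) : (phases n).Normal where
  conj_mem := by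
    rintro U ⟨z, hz⟩ g
    refine ⟨z, ?_⟩
    have h : (g : Op n) * ((g⁻¹ : QubitUnitary n) : Op n) = 1 := by
      rw [← Submonoid.coe_mul, mul_inv_cancel, Submonoid.coe_one]
    rw [Submonoid.coe_mul, Submonoid.coe_mul, hz]
    simp only [Matrix.mul_smul, Matrix.smul_mul, mul_one, h]

/-- `H` modulo global phases is isomorphic to `SO(2n)` as a topological group, through the action of
`H` on the span of the Majorana operators. The matrix of that linear map in the basis `(c_ℓ)` is
the transpose of the matrix `R` in `U c_ℓ U† = ∑ₘ R_{ℓm} c_m`. -/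
def IsRotationGroupModPhases {n : ℕ} (H : Subgroup (QubitUnitary n)) : Prop :=
  ∃ φ : (H ⧸ (phases n).subgroupOf H) ≃ₜ* Matrix.specialOrthogonalGroup (Fin (2 * n)) ℝ,
    ∀ U : H, ActsBy (U : QubitUnitary n)
      (φ (QuotientGroup.mk U) : Matrix (Fin (2 * n)) (Fin (2 * n)) ℝ).transpose

end Matchgate

/-! Conjugation by `exp (θ c_l c_m)` rotates the plane of `c_l` and `c_m` by the angle `2θ` and
fixes the other Majorana operators. For adjacent indices the Jordan–Wigner strings cancel: `c_l
c_{l+1}` is `iZ` on one qubit or `iX ⊗ X` on two neighbours, so its exponential is a normalised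
matchgate. Conversely, Euler angles in `SU(2)` factor every normalised matchgate into such
exponentials. Thus `G_1` is generated by the adjacent Givens rotations `givensGates`
(`specialMatchgateGroup_eq_closure_givensGates`).

Givens elimination writes every `R ∈ SO(2n)` as at most `(2n-1)²` adjacent plane rotations
(`exists_product_actsBy`). The Majorana operators generate the full matrix algebra, so a unitary is
determined by its action on them up to a phase (`ActsBy.exists_eq_smul`). Scalars of modulus one are
themselves matchgates, hence `G` is the whole group `rotationGroup`, at the cost of one more gate.

For `G_1` the phase must be controlled. All its elements commute with an antiunitary operator,
`conjugator` composed with complex conjugation, and the only phases that do so are `±1`; moreover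
`-1` is a single Givens gate. Hence `G_1 = rotationGroup ⊓ realGroup`, with the same gate count.

Both groups are now cut out by closed conditions in a compact unitary group, so they are compact.
The action on the Majorana operators is a continuous surjection onto `SO(2n)` with kernel the
phases, and a continuous bijection from a compact space to a Hausdorff one is a homeomorphism. -/

namespace Matchgate

/-! ### Algebra of tensor products of one-qubit operators. -/

section TensorOp

variable {n : ℕ}

theorem tensorOp_mul (P Q : Fin n → Matrix (Fin 2) (Fin 2) ℂ) :
    tensorOp P * tensorOp Q = tensorOp fun j => P j * Q j := by
  ext x y
  simp only [tensorOp, Matrix.mul_apply, Matrix.of_apply]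
  rw [Finset.prod_univ_sum]
  simp [Finset.prod_mul_distrib]

theorem tensorOp_one : tensorOp (fun _ : Fin n => (1 : Matrix (Fin 2) (Fin 2) ℂ)) = 1 := by
  ext x y
  simp only [tensorOp, Matrix.of_apply, Matrix.one_apply]
  by_cases h : x = y
  · simp [h]
  · rw [if_neg h]
    obtain ⟨j, hj⟩ := Function.ne_iff.mp h
    exact Finset.prod_eq_zero (Finset.mem_univ j) (if_neg hj)

theorem tensorOp_smul (s : Fin n → ℂ) (P : Fin n → Matrix (Fin 2) (Fin 2) ℂ) :
    tensorOp (fun j => s j • P j) = (∏ j, s j) • tensorOp P := by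
  ext x y
  simp [tensorOp, Finset.prod_mul_distrib]

theorem conjTranspose_tensorOp (P : Fin n → Matrix (Fin 2) (Fin 2) ℂ) :
    (tensorOp P).conjTranspose = tensorOp fun j => (P j).conjTranspose := by
  ext x y
  simp [tensorOp]

theorem map_star_tensorOp (P : Fin n → Matrix (Fin 2) (Fin 2) ℂ) :
    (tensorOp P).map star = tensorOp fun j => (P j).map star := by
  ext x y
  simp [tensorOp]

/-- If the tensor factors commute except at the site `k`, where they anticommute, then the tensor
products anticommute. -/
theorem tensorOp_anticommute (k : Fin n) (P Q : Fin n → Matrix (Fin 2) (Fin 2) ℂ)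
    (hk : P k * Q k = -(Q k * P k)) (h : ∀ j, j ≠ k → P j * Q j = Q j * P j) :
    tensorOp P * tensorOp Q = -(tensorOp Q * tensorOp P) := by
  rw [tensorOp_mul, tensorOp_mul, ← neg_one_smul ℂ]
  -- The global sign is distributed over the sites, all of it landing on `k`.
  have : (-1 : ℂ) = ∏ j : Fin n, if j = k then -1 else 1 := by simp
  rw [this, ← tensorOp_smul]
  congr 1
  funext j
  by_cases hj : j = k
  · subst hj; simp [hk]
  · simp [hj, h j hj]

end TensorOp

/-! ### Pauli matrices. -/

section Pauli

theorem pauliX_mul_self : pauliX * pauliX = 1 := by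
  ext i j; fin_cases i <;> fin_cases j <;> simp [pauliX]

theorem pauliY_mul_self : pauliY * pauliY = 1 := by
  ext i j; fin_cases i <;> fin_cases j <;> simp [pauliY]

theorem pauliZ_mul_self : pauliZ * pauliZ = 1 := by
  ext i j; fin_cases i <;> fin_cases j <;> simp [pauliZ]

theorem pauliX_mul_pauliY : pauliX * pauliY = Complex.I • pauliZ := by
  ext i j; fin_cases i <;> fin_cases j <;> simp [pauliX, pauliY, pauliZ]

theorem pauliY_mul_pauliX : pauliY * pauliX = -(Complex.I • pauliZ) := by
  ext i j; fin_cases i <;> fin_cases j <;> simp [pauliX, pauliY, pauliZ]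

theorem pauliY_mul_pauliZ : pauliY * pauliZ = Complex.I • pauliX := by
  ext i j; fin_cases i <;> fin_cases j <;> simp [pauliX, pauliY, pauliZ]

theorem pauliZ_mul_pauliY : pauliZ * pauliY = -(Complex.I • pauliX) := by
  ext i j; fin_cases i <;> fin_cases j <;> simp [pauliX, pauliY, pauliZ]

theorem pauliX_mul_pauliZ : pauliX * pauliZ = -(pauliZ * pauliX) := by
  ext i j; fin_cases i <;> fin_cases j <;> simp [pauliX, pauliZ]

theorem conjTranspose_pauliX : pauliX.conjTranspose = pauliX := by
  ext i j; fin_cases i <;> fin_cases j <;> simp [pauliX]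

theorem conjTranspose_pauliY : pauliY.conjTranspose = pauliY := by
  ext i j; fin_cases i <;> fin_cases j <;> simp [pauliY]

theorem conjTranspose_pauliZ : pauliZ.conjTranspose = pauliZ := by
  ext i j; fin_cases i <;> fin_cases j <;> simp [pauliZ]

end Pauli

/-! ### Clifford relations for the Majorana operators. -/

section Clifford

variable {n : ℕ}

theorem majorana_mul_self (l : Fin (2 * n)) :
    (majorana l : Op n) * majorana l = 1 := by
  rw [majorana, tensorOp_mul, ← tensorOp_one]
  congr 1
  funext j
  split_ifs <;> simp [pauliX_mul_self, pauliY_mul_self, pauliZ_mul_self]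

theorem conjTranspose_majorana (l : Fin (2 * n)) :
    (majorana l : Op n).conjTranspose = majorana l := by
  rw [majorana, conjTranspose_tensorOp]
  congr 1
  funext j
  split_ifs <;> simp [conjTranspose_pauliX, conjTranspose_pauliY, conjTranspose_pauliZ]

/-- The site `l / 2` carries the only anticommuting factors: there `X` or `Y` meets the string
factor `Z`, or `X` meets `Y` when both operators end on the same qubit. Before it both have `Z`,
after it the first has the identity. -/
theorem majorana_anticommute_of_lt {l m : Fin (2 * n)} (h : l < m) :
    (majorana l : Op n) * majorana m = -(majorana m * majorana l) := by
  have hlm : (l : ℕ) < m := h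
  have hl : (l : ℕ) / 2 < n := by omega
  refine tensorOp_anticommute ⟨(l : ℕ) / 2, hl⟩ _ _ ?_ ?_
  · simp only [lt_irrefl, if_true, if_false]
    rcases eq_or_ne ((l : ℕ) / 2) ((m : ℕ) / 2) with e | e
    · have h0 : (l : ℕ) % 2 = 0 := by omega
      have h1 : ¬ (m : ℕ) % 2 = 0 := by omega
      have h2 : ¬ (l : ℕ) / 2 < (m : ℕ) / 2 := by omega
      rw [if_pos h0, if_neg h2, if_pos e, if_neg h1, pauliX_mul_pauliY, pauliY_mul_pauliX, neg_neg]
    · have h2 : (l : ℕ) / 2 < (m : ℕ) / 2 := by omega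
      rw [if_pos h2]
      split_ifs
      · exact pauliX_mul_pauliZ
      · rw [pauliY_mul_pauliZ, pauliZ_mul_pauliY, neg_neg]
  · intro j hj
    have hj' : ¬ (j : ℕ) = (l : ℕ) / 2 := fun e => hj (Fin.ext e)
    rw [if_neg hj']
    by_cases h1 : (j : ℕ) < (l : ℕ) / 2
    · have h2 : (j : ℕ) < (m : ℕ) / 2 := by omega
      rw [if_pos h1, if_pos h2]
    · rw [if_neg h1, one_mul, mul_one]

theorem majorana_anticommute {l m : Fin (2 * n)} (h : l ≠ m) :
    (majorana l : Op n) * majorana m = -(majorana m * majorana l) := by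
  rcases lt_or_gt_of_ne h with h | h
  · exact majorana_anticommute_of_lt h
  · rw [majorana_anticommute_of_lt h, neg_neg]

theorem majorana_anticommutator (l m : Fin (2 * n)) :
    (majorana l : Op n) * majorana m + majorana m * majorana l = if l = m then 2 else 0 := by
  split_ifs with h
  · subst h
    rw [majorana_mul_self, one_add_one_eq_two]
  · rw [majorana_anticommute h, neg_add_cancel]

/-- The real span of the Majorana operators. -/
noncomputable def majoranaSum (v : Fin (2 * n) → ℝ) : Op n := ∑ m, (v m : ℂ) • majorana m

/-- Coefficients are read off by anticommutators; this yields both linear independence and a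
continuous formula for the rotation matrix. -/
theorem majoranaSum_anticommutator (v : Fin (2 * n) → ℝ) (l : Fin (2 * n)) :
    majoranaSum v * majorana l + majorana l * majoranaSum v = (2 * v l : ℂ) • (1 : Op n) := by
  simp only [majoranaSum, Finset.sum_mul, Finset.mul_sum, Matrix.smul_mul, Matrix.mul_smul]
  rw [← Finset.sum_add_distrib]
  simp only [← smul_add, majorana_anticommutator]
  simp only [smul_ite, smul_zero, Finset.sum_ite_eq', Finset.mem_univ, if_true]
  rw [mul_comm, mul_smul, ofNat_smul_eq_nsmul, two_smul, one_add_one_eq_two]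

end Clifford

/-! ### Two-qubit operators and the gates `G(A, B)`. -/

section OnPair

variable {n : ℕ}

theorem onPair_add (i j : Fin n) (M N : Matrix (Fin 4) (Fin 4) ℂ) :
    onPair i j (M + N) = onPair i j M + onPair i j N := by
  ext x y
  simp only [onPair, Matrix.of_apply, Matrix.add_apply]
  split_ifs <;> simp

theorem onPair_smul (i j : Fin n) (z : ℂ) (M : Matrix (Fin 4) (Fin 4) ℂ) :
    onPair i j (z • M) = z • onPair i j M := by
  ext x y
  simp only [onPair, Matrix.of_apply, Matrix.smul_apply]
  split_ifs <;> simp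

theorem onPair_eq_tensorOp {i j : Fin n} (hij : i ≠ j) {M : Matrix (Fin 4) (Fin 4) ℂ}
    {P Q : Matrix (Fin 2) (Fin 2) ℂ}
    (h : ∀ a b c d, M (pairIndex a b) (pairIndex c d) = P a c * Q b d) :
    onPair i j M = tensorOp fun m => if m = i then P else if m = j then Q else 1 := by
  ext x y
  simp only [onPair, tensorOp, Matrix.of_apply]
  rw [← Finset.mul_prod_erase _ _ (Finset.mem_univ i),
    ← Finset.mul_prod_erase _ _ (Finset.mem_erase.2 ⟨hij.symm, Finset.mem_univ j⟩)]
  -- The identity factors give Kronecker deltas, whose product is the agreement condition in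
  -- `onPair`.
  have hR : ∏ m ∈ (Finset.univ.erase i).erase j,
      (if m = i then P else if m = j then Q else 1) (x m) (y m)
      = ∏ m ∈ (Finset.univ.erase i).erase j, if x m = y m then 1 else 0 := by
    refine Finset.prod_congr rfl fun m hm => ?_
    simp only [Finset.mem_erase] at hm
    rw [if_neg hm.2.1, if_neg hm.1, Matrix.one_apply]
  rw [hR, if_pos rfl, if_neg hij.symm, if_pos rfl, h, Finset.prod_ite_zero, ← mul_assoc]
  simp only [Finset.mem_erase, Finset.mem_univ, and_true, Finset.prod_const_one]
  by_cases hx : ∀ k, k ≠ i → k ≠ j → x k = y k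
  · rw [if_pos hx, if_pos fun k hk => hx k hk.2 hk.1, mul_one]
  · rw [if_neg hx, if_neg fun hk => hx fun k h1 h2 => hk k ⟨h2, h1⟩, mul_zero]

theorem onPair_mul {i j : Fin n} (hij : i ≠ j) (M N : Matrix (Fin 4) (Fin 4) ℂ) :
    onPair i j (M * N) = onPair i j M * onPair i j N := by
  ext x y
  rw [Matrix.mul_apply]
  -- Only intermediate strings that agree with `x` away from `i` and `j` contribute; `e`
  -- parametrises them by their two free bits.
  let e : Fin 2 × Fin 2 → Fin n → Fin 2 := fun p =>
    Function.update (Function.update x i p.1) j p.2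
  have ei : ∀ p, e p i = p.1 := fun p => by simp [e, hij]
  have ej : ∀ p, e p j = p.2 := fun p => by simp [e]
  have ek : ∀ p k, k ≠ i → k ≠ j → e p k = x k := fun p k h1 h2 => by simp [e, h1, h2]
  have he : Function.Injective e := fun p q hpq =>
    Prod.ext (by rw [← ei p, hpq, ei]) (by rw [← ej p, hpq, ej])
  rw [← Fintype.sum_of_injective e he
    (fun p => onPair i j M x (e p) * onPair i j N (e p) y) _ ?_ fun _ => rfl]
  · simp only [onPair, Matrix.of_apply, ei, ej]
    have h1 : ∀ p, ∀ k, k ≠ i → k ≠ j → x k = e p k := fun p k a b => (ek p k a b).symm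
    have h2 : ∀ p, (∀ k, k ≠ i → k ≠ j → e p k = y k) ↔ ∀ k, k ≠ i → k ≠ j → x k = y k :=
      fun p => forall_congr' fun k => by
        constructor <;> intro h a b
        · rw [← ek p k a b, h a b]
        · rw [ek p k a b, h a b]
    simp only [h2, if_pos (h1 _)]
    split_ifs
    · rw [Matrix.mul_apply, Fintype.sum_prod_type]
      simp [Fin.sum_univ_four, pairIndex, add_assoc]
    · simp
  · intro z hz
    have : ¬ ∀ k, k ≠ i → k ≠ j → x k = z k := by
      intro h
      refine hz ⟨(z i, z j), funext fun k => ?_⟩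
      by_cases hj : k = j
      · rw [hj, ej]
      by_cases hi : k = i
      · rw [hi, ei]
      rw [ek _ k hi hj, h k hi hj]
    simp [onPair, this]

theorem onPair_one {i j : Fin n} (hij : i ≠ j) : onPair i j 1 = 1 := by
  rw [onPair_eq_tensorOp hij (P := 1) (Q := 1), ← tensorOp_one]
  · congr 1
    funext m
    split_ifs <;> rfl
  · intro a b c d
    fin_cases a <;> fin_cases b <;> fin_cases c <;> fin_cases d <;>
      simp [pairIndex]

theorem gateMatrix_mul (A B C D : Matrix (Fin 2) (Fin 2) ℂ) :
    gateMatrix A B * gateMatrix C D = gateMatrix (A * C) (B * D) := by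
  ext i j
  fin_cases i <;> fin_cases j <;> simp [gateMatrix, Matrix.mul_apply, Fin.sum_univ_four]

theorem gateMatrix_smul (z : ℂ) (A B : Matrix (Fin 2) (Fin 2) ℂ) :
    gateMatrix (z • A) (z • B) = z • gateMatrix A B := by
  ext i j
  fin_cases i <;> fin_cases j <;> simp [gateMatrix]

theorem gateMatrix_add (A B C D : Matrix (Fin 2) (Fin 2) ℂ) :
    gateMatrix (A + C) (B + D) = gateMatrix A B + gateMatrix C D := by
  ext i j
  fin_cases i <;> fin_cases j <;> simp [gateMatrix]

theorem gateMatrix_one : gateMatrix 1 1 = 1 := by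
  ext i j
  fin_cases i <;> fin_cases j <;> simp [gateMatrix]

end OnPair

/-! ### Exponentials of operators with square `-1`. -/

section Rotor

variable {ι : Type*} [DecidableEq ι]

/-- `cos θ + sin θ E`, which is `exp (θ E)` when `E² = -1`. -/
noncomputable def rotor (E : Matrix ι ι ℂ) (θ : ℝ) : Matrix ι ι ℂ :=
  (Real.cos θ : ℂ) • (1 : Matrix ι ι ℂ) + (Real.sin θ : ℂ) • E

theorem rotor_zero (E : Matrix ι ι ℂ) : rotor E 0 = 1 := by simp [rotor]

theorem rotor_neg (E : Matrix ι ι ℂ) (θ : ℝ) : rotor (-E) θ = rotor E (-θ) := by simp [rotor]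

theorem rotor_mul_rotor [Fintype ι] {E : Matrix ι ι ℂ} (hE : E * E = -1) (a b : ℝ) :
    rotor E a * rotor E b = rotor E (a + b) := by
  simp only [rotor, add_mul, mul_add, Matrix.smul_mul, Matrix.mul_smul, hE, one_mul, mul_one,
    Real.cos_add, Real.sin_add]
  push_cast
  module

theorem conjTranspose_rotor {E : Matrix ι ι ℂ} (hE : E.conjTranspose = -E) (θ : ℝ) :
    (rotor E θ).conjTranspose = rotor E (-θ) := by
  simp only [rotor, Matrix.conjTranspose_add, Matrix.conjTranspose_smul, Matrix.conjTranspose_one,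
    hE, Complex.star_def, Complex.conj_ofReal, Real.cos_neg, Real.sin_neg]
  push_cast
  module

theorem rotor_mem_unitaryGroup [Fintype ι] {E : Matrix ι ι ℂ} (hE : E * E = -1) (hE' : E.conjTranspose = -E)
    (θ : ℝ) : rotor E θ ∈ Matrix.unitaryGroup ι ℂ := by
  rw [Matrix.mem_unitaryGroup_iff, Matrix.star_eq_conjTranspose, conjTranspose_rotor hE',
    rotor_mul_rotor hE, add_neg_cancel, rotor_zero]

end Rotor

/-! ### Unitaries acting linearly on the Majorana operators. -/

section ActsBy

variable {n : ℕ}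

theorem majoranaSum_add (v w : Fin (2 * n) → ℝ) :
    majoranaSum (v + w) = majoranaSum v + majoranaSum w := by
  simp [majoranaSum, add_smul, Finset.sum_add_distrib]

theorem majoranaSum_smul (r : ℝ) (v : Fin (2 * n) → ℝ) :
    majoranaSum (r • v) = (r : ℂ) • majoranaSum v := by
  simp only [majoranaSum, Finset.smul_sum, smul_smul, Pi.smul_apply, smul_eq_mul,
    Complex.ofReal_mul]

theorem one_row (l : Fin (2 * n)) :
    (1 : Matrix (Fin (2 * n)) (Fin (2 * n)) ℝ) l = Pi.single l 1 :=
  funext fun _ => Matrix.one_eq_pi_single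

theorem majoranaSum_single (l : Fin (2 * n)) : majoranaSum (Pi.single l 1) = majorana l := by
  rw [majoranaSum, Finset.sum_eq_single l]
  · simp
  · intro m _ h
    simp [h]
  · simp

theorem smul_one_injective {z w : ℂ} (h : z • (1 : Op n) = w • (1 : Op n)) : z = w := by
  simpa using congrFun (congrFun h 0) 0

theorem majoranaSum_injective : Function.Injective (majoranaSum (n := n)) := by
  intro v w h
  funext l
  have := (majoranaSum_anticommutator v l).symm.trans
    ((by rw [h] : _ = _).trans (majoranaSum_anticommutator w l))
  have := smul_one_injective this
  exact_mod_cast mul_left_cancel₀ two_ne_zero this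

theorem majoranaSum_anticommutator_majoranaSum (v w : Fin (2 * n) → ℝ) :
    majoranaSum v * majoranaSum w + majoranaSum w * majoranaSum v
      = (2 * (v ⬝ᵥ w : ℝ) : ℂ) • (1 : Op n) := by
  have h : ∀ l, majoranaSum v * ((w l : ℂ) • majorana l) + ((w l : ℂ) • majorana l) * majoranaSum v
      = (2 * v l * w l : ℂ) • (1 : Op n) := fun l => by
    rw [Matrix.mul_smul, Matrix.smul_mul, ← smul_add, majoranaSum_anticommutator, smul_smul,
      mul_comm]
  conv_lhs => rw [show majoranaSum w = ∑ l, (w l : ℂ) • majorana l from rfl]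
  rw [Finset.mul_sum, Finset.sum_mul, ← Finset.sum_add_distrib]
  simp only [h]
  rw [← Finset.sum_smul, dotProduct]
  push_cast
  rw [Finset.mul_sum]
  simp only [mul_assoc]

theorem conjTranspose_mul_self (U : QubitUnitary n) : (U : Op n).conjTranspose * (U : Op n) = 1 :=
  Matrix.UnitaryGroup.star_mul_self U

theorem mul_conjTranspose_self (U : QubitUnitary n) : (U : Op n) * (U : Op n).conjTranspose = 1 :=
  Matrix.mem_unitaryGroup_iff.1 U.2

theorem conj_mul (U : QubitUnitary n) (M N : Op n) :
    (U : Op n) * M * (U : Op n).conjTranspose * ((U : Op n) * N * (U : Op n).conjTranspose)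
      = (U : Op n) * (M * N) * (U : Op n).conjTranspose := by
  calc _ = (U : Op n) * M * ((U : Op n).conjTranspose * (U : Op n)) * N
        * (U : Op n).conjTranspose := by simp only [mul_assoc]
    _ = _ := by rw [conjTranspose_mul_self, mul_one, mul_assoc _ M N]

theorem conjTranspose_conj {U : QubitUnitary n} {M N : Op n}
    (h : (U : Op n) * M * (U : Op n).conjTranspose = N) :
    (U : Op n).conjTranspose * N * (U : Op n) = M := by
  rw [← h]
  calc _ = ((U : Op n).conjTranspose * (U : Op n)) * M * ((U : Op n).conjTranspose * (U : Op n)) :=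
        by simp only [mul_assoc]
    _ = _ := by rw [conjTranspose_mul_self, mul_one, one_mul]

theorem commute_of_conj_eq {U : QubitUnitary n} {M : Op n}
    (h : (U : Op n) * M * (U : Op n).conjTranspose = M) : (U : Op n) * M = M * (U : Op n) := by
  conv_rhs => rw [← h]
  rw [mul_assoc, conjTranspose_mul_self, mul_one]

theorem ActsBy.conj_majorana {U : QubitUnitary n} {R : Matrix (Fin (2 * n)) (Fin (2 * n)) ℝ}
    (h : ActsBy U R) (l : Fin (2 * n)) :
    (U : Op n) * majorana l * (U : Op n).conjTranspose = majoranaSum (R l) := h l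

theorem ActsBy.conj_majoranaSum {U : QubitUnitary n} {R : Matrix (Fin (2 * n)) (Fin (2 * n)) ℝ}
    (h : ActsBy U R) (v : Fin (2 * n) → ℝ) :
    (U : Op n) * majoranaSum v * (U : Op n).conjTranspose = majoranaSum (Matrix.vecMul v R) := by
  have : ∀ l, (U : Op n) * ((v l : ℂ) • majorana l) * (U : Op n).conjTranspose
      = (v l : ℂ) • ∑ m, (R l m : ℂ) • majorana m := fun l => by
    rw [Matrix.mul_smul, Matrix.smul_mul, h l]
  simp only [majoranaSum, Finset.mul_sum, Finset.sum_mul, this, Finset.smul_sum, smul_smul]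
  rw [Finset.sum_comm]
  refine Finset.sum_congr rfl fun m _ => ?_
  rw [← Finset.sum_smul, Matrix.vecMul, dotProduct]
  push_cast
  rfl

theorem actsBy_one : ActsBy (1 : QubitUnitary n) 1 := by
  intro l
  change _ = majoranaSum ((1 : Matrix (Fin (2 * n)) (Fin (2 * n)) ℝ) l)
  rw [one_row, majoranaSum_single]
  simp

/-- The order reverses because coefficient vectors are rows, multiplied by the matrix on the right.
-/
theorem ActsBy.mul {U V : QubitUnitary n} {R S : Matrix (Fin (2 * n)) (Fin (2 * n)) ℝ}
    (hR : ActsBy U R) (hS : ActsBy V S) : ActsBy (U * V) (S * R) := by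
  intro l
  change _ = majoranaSum ((S * R) l)
  rw [Matrix.mul_apply_eq_vecMul, ← hR.conj_majoranaSum, ← hS.conj_majorana,
    Matrix.UnitaryGroup.mul_val, Matrix.conjTranspose_mul]
  simp only [mul_assoc]

/-- Conjugation preserves anticommutators, and these encode the Euclidean inner product of
coefficient vectors; so orthogonality is automatic and only the determinant is a genuine condition.
-/
theorem ActsBy.mul_transpose {U : QubitUnitary n} {R : Matrix (Fin (2 * n)) (Fin (2 * n)) ℝ}
    (h : ActsBy U R) : R * R.transpose = 1 := by
  ext l m
  have e := majoranaSum_anticommutator_majoranaSum (R l) (R m)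
  rw [← h.conj_majorana, ← h.conj_majorana, conj_mul, conj_mul, ← add_mul, ← mul_add,
    majorana_anticommutator] at e
  have e' : (if l = m then 2 else 0 : ℂ) = 2 * ((R l ⬝ᵥ R m : ℝ) : ℂ) := by
    apply smul_one_injective (n := n)
    rw [← e]
    split_ifs
    · rw [show (2 : Op n) = (2 : ℂ) • (1 : Op n) by
        rw [ofNat_smul_eq_nsmul, two_smul, one_add_one_eq_two], Matrix.mul_smul, Matrix.smul_mul,
        mul_one, mul_conjTranspose_self]
    · simp
  rw [Matrix.mul_apply', Matrix.one_apply]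
  change R l ⬝ᵥ R m = _
  have e'' : (if l = m then 2 else 0 : ℝ) = 2 * (R l ⬝ᵥ R m) := by
    split_ifs at e' ⊢ <;> exact_mod_cast e'
  split_ifs at e'' ⊢ <;> linarith

theorem ActsBy.inv {U : QubitUnitary n} {R : Matrix (Fin (2 * n)) (Fin (2 * n)) ℝ}
    (h : ActsBy U R) : ActsBy U⁻¹ R.transpose := by
  intro l
  change _ = majoranaSum (R.transpose l)
  rw [Matrix.UnitaryGroup.inv_val, Matrix.star_eq_conjTranspose, Matrix.conjTranspose_conjTranspose]
  apply conjTranspose_conj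
  rw [h.conj_majoranaSum, ← Matrix.mul_apply_eq_vecMul, mul_eq_one_comm.1 h.mul_transpose,
    one_row, majoranaSum_single]

theorem ActsBy.mem_specialOrthogonalGroup_iff {U : QubitUnitary n}
    {R : Matrix (Fin (2 * n)) (Fin (2 * n)) ℝ} (h : ActsBy U R) :
    R ∈ Matrix.specialOrthogonalGroup (Fin (2 * n)) ℝ ↔ R.det = 1 := by
  rw [Matrix.mem_specialOrthogonalGroup_iff, Matrix.mem_orthogonalGroup_iff]
  exact and_iff_right h.mul_transpose

theorem ActsBy.det_mul_self {U : QubitUnitary n} {R : Matrix (Fin (2 * n)) (Fin (2 * n)) ℝ}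
    (h : ActsBy U R) : R.det * R.det = 1 := by
  have := congrArg Matrix.det h.mul_transpose
  rwa [Matrix.det_mul, Matrix.det_transpose, Matrix.det_one] at this

theorem actsAsProperRotation_iff {U : QubitUnitary n} :
    ActsAsProperRotation U ↔ ∃ R, ActsBy U R ∧ R.det = 1 := by
  constructor
  · rintro ⟨R, hR, h⟩
    exact ⟨R, h, h.mem_specialOrthogonalGroup_iff.1 hR⟩
  · rintro ⟨R, h, hR⟩
    exact ⟨R, h.mem_specialOrthogonalGroup_iff.2 hR, h⟩

variable (n) in
/-- The unitaries acting as proper rotations form a group. -/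
def rotationGroup : Subgroup (QubitUnitary n) where
  carrier := {U | ActsAsProperRotation U}
  one_mem' := actsAsProperRotation_iff.2 ⟨1, actsBy_one, Matrix.det_one⟩
  mul_mem' := by
    intro U V hU hV
    obtain ⟨R, hR, dR⟩ := actsAsProperRotation_iff.1 hU
    obtain ⟨S, hS, dS⟩ := actsAsProperRotation_iff.1 hV
    exact actsAsProperRotation_iff.2 ⟨S * R, hR.mul hS, by rw [Matrix.det_mul, dR, dS, one_mul]⟩
  inv_mem' := by
    intro U hU
    obtain ⟨R, hR, dR⟩ := actsAsProperRotation_iff.1 hU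
    exact actsAsProperRotation_iff.2 ⟨_, hR.inv, by rw [Matrix.det_transpose, dR]⟩

theorem mem_rotationGroup {U : QubitUnitary n} : U ∈ rotationGroup n ↔ ActsAsProperRotation U :=
  Iff.rfl

theorem norm_eq_one_of_smul {z : ℂ} {U V : QubitUnitary n} (h : (U : Op n) = z • (V : Op n)) :
    z * star z = 1 := by
  have e := mul_conjTranspose_self U
  rw [h, Matrix.conjTranspose_smul, Matrix.smul_mul, Matrix.mul_smul, mul_conjTranspose_self,
    smul_smul] at e
  exact smul_one_injective (e.trans (one_smul ℂ _).symm)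

theorem ActsBy.of_smul {z : ℂ} {U V : QubitUnitary n} (h : (U : Op n) = z • (V : Op n))
    {R : Matrix (Fin (2 * n)) (Fin (2 * n)) ℝ} (hV : ActsBy V R) : ActsBy U R := by
  intro l
  rw [← hV l, h, Matrix.conjTranspose_smul, Matrix.smul_mul, Matrix.smul_mul, Matrix.mul_smul,
    smul_smul, norm_eq_one_of_smul h, one_smul]

end ActsBy

/-! ### Plane rotations implemented by `exp (θ c_l c_m)`. -/

section Givens

variable {n : ℕ}

theorem majorana_pair_mul_self {l m : Fin (2 * n)} (h : l ≠ m) :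
    (majorana l * majorana m : Op n) * (majorana l * majorana m) = -1 := by
  rw [mul_assoc, ← mul_assoc (majorana m), majorana_anticommute h.symm, neg_mul, mul_neg,
    mul_assoc, majorana_mul_self, mul_one, majorana_mul_self]

theorem conjTranspose_majorana_pair {l m : Fin (2 * n)} (h : l ≠ m) :
    (majorana l * majorana m : Op n).conjTranspose = -(majorana l * majorana m) := by
  rw [Matrix.conjTranspose_mul, conjTranspose_majorana, conjTranspose_majorana,
    majorana_anticommute h, neg_neg]

/-- The unitary `exp (θ c_l c_m)`. -/
noncomputable def givensUnitary {l m : Fin (2 * n)} (h : l ≠ m) (θ : ℝ) : QubitUnitary n :=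
  ⟨rotor (majorana l * majorana m) θ,
    rotor_mem_unitaryGroup (majorana_pair_mul_self h) (conjTranspose_majorana_pair h) θ⟩

theorem coe_givensUnitary {l m : Fin (2 * n)} (h : l ≠ m) (θ : ℝ) :
    (givensUnitary h θ : Op n) = rotor (majorana l * majorana m) θ := rfl

theorem givensUnitary_mul {l m : Fin (2 * n)} (h : l ≠ m) (a b : ℝ) :
    givensUnitary h a * givensUnitary h b = givensUnitary h (a + b) :=
  Subtype.ext (rotor_mul_rotor (majorana_pair_mul_self h) a b)

/-- The rotation by the angle `φ` in the plane of the coordinates `l` and `m`. -/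
noncomputable def planeRotation (l m : Fin (2 * n)) (φ : ℝ) :
    Matrix (Fin (2 * n)) (Fin (2 * n)) ℝ :=
  1 + Matrix.vecMulVec (Pi.single l 1) ((Real.cos φ - 1) • Pi.single l 1 - Real.sin φ • Pi.single m 1)
    + Matrix.vecMulVec (Pi.single m 1)
      (Real.sin φ • Pi.single l 1 + (Real.cos φ - 1) • Pi.single m 1)

theorem vecMul_planeRotation (l m : Fin (2 * n)) (φ : ℝ) (v : Fin (2 * n) → ℝ) :
    Matrix.vecMul v (planeRotation l m φ) = v
      + v l • ((Real.cos φ - 1) • Pi.single l 1 - Real.sin φ • Pi.single m 1)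
      + v m • (Real.sin φ • Pi.single l 1 + (Real.cos φ - 1) • Pi.single m 1) := by
  rw [planeRotation, Matrix.vecMul_add, Matrix.vecMul_add, Matrix.vecMul_one,
    Matrix.vecMul_vecMulVec, Matrix.vecMul_vecMulVec]
  simp

/-- The angle doubles because `c_l` anticommutes with `c_l c_m`, so the two exponential factors
reinforce each other. -/
theorem givensUnitary_conj_fst {l m : Fin (2 * n)} (h : l ≠ m) (θ : ℝ) :
    (givensUnitary h θ : Op n) * majorana l * (givensUnitary h θ : Op n).conjTranspose
      = (Real.cos (2 * θ) : ℂ) • majorana l - (Real.sin (2 * θ) : ℂ) • majorana m := by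
  rw [coe_givensUnitary, conjTranspose_rotor (conjTranspose_majorana_pair h)]
  have e1 : (majorana l * majorana m : Op n) * majorana l = -majorana m := by
    rw [majorana_anticommute h, neg_mul, mul_assoc, majorana_mul_self, mul_one]
  have e2 : (majorana l : Op n) * (majorana l * majorana m) = majorana m := by
    rw [← mul_assoc, majorana_mul_self, one_mul]
  have e3 : (majorana m : Op n) * (majorana l * majorana m) = -majorana l := by
    rw [← mul_assoc, majorana_anticommute h.symm, neg_mul, mul_assoc, majorana_mul_self, mul_one]
  simp only [rotor, add_mul, mul_add, Matrix.smul_mul, Matrix.mul_smul, one_mul, mul_one, e1, e2,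
    Matrix.neg_mul, e3, Real.cos_neg, Real.sin_neg, Real.cos_two_mul', Real.sin_two_mul]
  push_cast
  module

theorem givensUnitary_conj_snd {l m : Fin (2 * n)} (h : l ≠ m) (θ : ℝ) :
    (givensUnitary h θ : Op n) * majorana m * (givensUnitary h θ : Op n).conjTranspose
      = (Real.sin (2 * θ) : ℂ) • majorana l + (Real.cos (2 * θ) : ℂ) • majorana m := by
  rw [coe_givensUnitary, conjTranspose_rotor (conjTranspose_majorana_pair h)]
  have e1 : (majorana l * majorana m : Op n) * majorana m = majorana l := by
    rw [mul_assoc, majorana_mul_self, mul_one]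
  have e2 : (majorana l : Op n) * (majorana l * majorana m) = majorana m := by
    rw [← mul_assoc, majorana_mul_self, one_mul]
  have e3 : (majorana m : Op n) * (majorana l * majorana m) = -majorana l := by
    rw [← mul_assoc, majorana_anticommute h.symm, neg_mul, mul_assoc, majorana_mul_self, mul_one]
  simp only [rotor, add_mul, mul_add, Matrix.smul_mul, Matrix.mul_smul, one_mul, mul_one, e1, e2,
    e3, Real.cos_neg, Real.sin_neg, Real.cos_two_mul', Real.sin_two_mul]
  push_cast
  module

theorem givensUnitary_conj_of_ne {l m k : Fin (2 * n)} (h : l ≠ m) (θ : ℝ) (hl : k ≠ l)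
    (hm : k ≠ m) :
    (givensUnitary h θ : Op n) * majorana k * (givensUnitary h θ : Op n).conjTranspose
      = majorana k := by
  have e : (majorana l * majorana m : Op n) * majorana k = majorana k * (majorana l * majorana m) := by
    rw [mul_assoc, majorana_anticommute hm.symm, mul_neg, ← mul_assoc, majorana_anticommute hl.symm,
      neg_mul, neg_neg, mul_assoc]
  have e' : (givensUnitary h θ : Op n) * majorana k = majorana k * (givensUnitary h θ : Op n) := by
    simp [coe_givensUnitary, rotor, add_mul, mul_add, e]
  rw [e', mul_assoc, mul_conjTranspose_self, mul_one]

theorem actsBy_givensUnitary {l m : Fin (2 * n)} (h : l ≠ m) (θ : ℝ) :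
    ActsBy (givensUnitary h θ) (planeRotation l m (2 * θ)) := by
  intro k
  change _ = majoranaSum (planeRotation l m (2 * θ) k)
  rw [← one_mul (planeRotation l m (2 * θ)), Matrix.mul_apply_eq_vecMul, vecMul_planeRotation,
    one_row]
  simp only [majoranaSum_add, majoranaSum_smul, sub_eq_add_neg, ← neg_smul, majoranaSum_single]
  by_cases hl : k = l
  · subst hl
    rw [givensUnitary_conj_fst, Pi.single_eq_same, Pi.single_eq_of_ne h.symm]
    push_cast
    module
  by_cases hm : k = m
  · subst hm
    rw [givensUnitary_conj_snd, Pi.single_eq_same, Pi.single_eq_of_ne h]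
    push_cast
    module
  rw [givensUnitary_conj_of_ne h θ hl hm, Pi.single_eq_of_ne (Ne.symm hl),
    Pi.single_eq_of_ne (Ne.symm hm)]
  simp

/-- The gate is the square of the gate with half the angle, so its determinant is the square of
`±1`; no explicit determinant is computed. -/
theorem givensUnitary_mem_rotationGroup {l m : Fin (2 * n)} (h : l ≠ m) (θ : ℝ) :
    givensUnitary h θ ∈ rotationGroup n := by
  have hR := actsBy_givensUnitary h (θ / 2)
  rw [← add_halves θ, ← givensUnitary_mul]
  exact actsAsProperRotation_iff.2 ⟨_, hR.mul hR, by rw [Matrix.det_mul, hR.det_mul_self]⟩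

variable (n) in
/-- The unitaries `exp (θ c_l c_{l+1})`. -/
def givensGates : Set (QubitUnitary n) :=
  {U | ∃ (l m : Fin (2 * n)) (h : l ≠ m), (m : ℕ) = (l : ℕ) + 1 ∧ ∃ θ, U = givensUnitary h θ}

theorem closure_givensGates_le_rotationGroup :
    Subgroup.closure (givensGates n) ≤ rotationGroup n := by
  rw [Subgroup.closure_le]
  rintro _ ⟨l, m, h, -, θ, rfl⟩
  exact givensUnitary_mem_rotationGroup h θ

end Givens

/-! ### Adjacent Majorana pairs as one- and two-qubit operators. -/

section LocalForm

variable {n : ℕ}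

theorem majorana_mul_succ_of_even {l m : Fin (2 * n)} {i : Fin n} (hl : (l : ℕ) = 2 * i)
    (hm : (m : ℕ) = 2 * i + 1) :
    (majorana l * majorana m : Op n)
      = tensorOp fun j => if j = i then Complex.I • pauliZ else 1 := by
  rw [majorana, majorana, tensorOp_mul]
  congr 1
  funext j
  have h1 : (l : ℕ) / 2 = i := by omega
  have h2 : (m : ℕ) / 2 = i := by omega
  have h3 : (l : ℕ) % 2 = 0 := by omega
  have h4 : (m : ℕ) % 2 = 1 := by omega
  simp only [h1, h2, h3, h4, if_true, one_ne_zero, if_false, Fin.ext_iff]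
  rcases lt_trichotomy (j : ℕ) i with h | h | h
  · rw [if_pos h, if_pos h, if_neg h.ne, pauliZ_mul_self]
  · rw [if_neg h.not_lt, if_neg h.not_lt, if_pos h, if_pos h, if_pos h, pauliX_mul_pauliY]
  · rw [if_neg h.not_gt, if_neg h.not_gt, if_neg h.ne', if_neg h.ne', if_neg h.ne', one_mul]

/-- The strings cancel below `i`; at `i` the remaining `Z` of the longer string turns `Y` into `iX`.
-/
theorem majorana_mul_succ_of_odd {l m : Fin (2 * n)} {i j : Fin n} (hl : (l : ℕ) = 2 * i + 1)
    (hm : (m : ℕ) = 2 * i + 2) (hj : (j : ℕ) = i + 1) :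
    (majorana l * majorana m : Op n)
      = tensorOp fun k => if k = i then Complex.I • pauliX else if k = j then pauliX else 1 := by
  rw [majorana, majorana, tensorOp_mul]
  congr 1
  funext k
  have h1 : (l : ℕ) / 2 = i := by omega
  have h2 : (m : ℕ) / 2 = i + 1 := by omega
  have h3 : (l : ℕ) % 2 = 1 := by omega
  have h4 : (m : ℕ) % 2 = 0 := by omega
  simp only [h1, h2, h3, h4, if_true, one_ne_zero, if_false, Fin.ext_iff, hj]
  rcases lt_trichotomy (k : ℕ) i with h | h | h
  · rw [if_pos h, if_pos (by omega), if_neg h.ne, if_neg (by omega), pauliZ_mul_self]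
  · rw [if_neg h.not_lt, if_pos h, if_pos (by omega), if_pos h, pauliY_mul_pauliZ]
  · rw [if_neg h.not_gt, if_neg h.ne', if_neg (show ¬ (k : ℕ) < i + 1 by omega), if_neg h.ne',
      one_mul]

theorem onPair_ZI {i j : Fin n} (hij : i ≠ j) :
    onPair i j (gateMatrix (Complex.I • pauliZ) (Complex.I • pauliZ))
      = tensorOp fun k => if k = i then Complex.I • pauliZ else 1 := by
  rw [onPair_eq_tensorOp hij (P := Complex.I • pauliZ) (Q := 1)]
  · simp
  · intro a b c d
    fin_cases a <;> fin_cases b <;> fin_cases c <;> fin_cases d <;>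
      simp [pairIndex, gateMatrix, pauliZ]

theorem onPair_IZ {i j : Fin n} (hij : i ≠ j) :
    onPair i j (gateMatrix (Complex.I • pauliZ) (-(Complex.I • pauliZ)))
      = tensorOp fun k => if k = j then Complex.I • pauliZ else 1 := by
  rw [onPair_eq_tensorOp hij (P := 1) (Q := Complex.I • pauliZ)]
  · congr 1
    funext k
    by_cases h : k = i
    · rw [if_pos h, if_neg (h ▸ hij)]
    · rw [if_neg h]
  · intro a b c d
    fin_cases a <;> fin_cases b <;> fin_cases c <;> fin_cases d <;>
      simp [pairIndex, gateMatrix, pauliZ]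

theorem onPair_XX {i j : Fin n} (hij : i ≠ j) :
    onPair i j (gateMatrix (Complex.I • pauliX) (Complex.I • pauliX))
      = tensorOp fun k => if k = i then Complex.I • pauliX else if k = j then pauliX else 1 := by
  refine onPair_eq_tensorOp hij ?_
  intro a b c d
  fin_cases a <;> fin_cases b <;> fin_cases c <;> fin_cases d <;>
    simp [pairIndex, gateMatrix, pauliX]

theorem onPair_gateMatrix_rotor {i j : Fin n} (hij : i ≠ j) (E F : Matrix (Fin 2) (Fin 2) ℂ)
    (θ : ℝ) : onPair i j (gateMatrix (rotor E θ) (rotor F θ))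
      = rotor (onPair i j (gateMatrix E F)) θ := by
  simp only [rotor, gateMatrix_add, gateMatrix_smul, gateMatrix_one, onPair_add, onPair_smul,
    onPair_one hij]

end LocalForm

/-! ### Euler decomposition in `SU(2)`. -/

section SU2

theorem I_smul_pauliZ_mul_self : (Complex.I • pauliZ) * (Complex.I • pauliZ) = -1 := by
  simp [smul_smul, pauliZ_mul_self]

theorem I_smul_pauliX_mul_self : (Complex.I • pauliX) * (Complex.I • pauliX) = -1 := by
  simp [smul_smul, pauliX_mul_self]

theorem rotor_I_smul_pauliZ (θ : ℝ) : rotor (Complex.I • pauliZ) θ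
    = !![Complex.exp (θ * Complex.I), 0; 0, Complex.exp (-(θ * Complex.I))] := by
  ext i j
  fin_cases i <;> fin_cases j <;>
    simp [rotor, pauliZ, Complex.exp_mul_I, ← neg_mul]

theorem rotor_I_smul_pauliX (θ : ℝ) : rotor (Complex.I • pauliX) θ
    = !![(Real.cos θ : ℂ), Real.sin θ * Complex.I; Real.sin θ * Complex.I, (Real.cos θ : ℂ)] := by
  ext i j
  fin_cases i <;> fin_cases j <;> simp [rotor, pauliX]

theorem rotor_I_smul_pauliZ_mem (θ : ℝ) :
    rotor (Complex.I • pauliZ) θ ∈ Matrix.unitaryGroup (Fin 2) ℂ :=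
  rotor_mem_unitaryGroup I_smul_pauliZ_mul_self
    (by rw [Matrix.conjTranspose_smul, conjTranspose_pauliZ]; simp) θ

theorem rotor_I_smul_pauliX_mem (θ : ℝ) :
    rotor (Complex.I • pauliX) θ ∈ Matrix.unitaryGroup (Fin 2) ℂ :=
  rotor_mem_unitaryGroup I_smul_pauliX_mul_self
    (by rw [Matrix.conjTranspose_smul, conjTranspose_pauliX]; simp) θ

theorem det_rotor_I_smul_pauliZ (θ : ℝ) : (rotor (Complex.I • pauliZ) θ).det = 1 := by
  simp [rotor_I_smul_pauliZ, ← Complex.exp_add]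

theorem det_rotor_I_smul_pauliX (θ : ℝ) : (rotor (Complex.I • pauliX) θ).det = 1 := by
  have h : ((Real.cos θ : ℂ)) ^ 2 + (Real.sin θ : ℂ) ^ 2 = 1 := by
    exact_mod_cast Real.cos_sq_add_sin_sq θ
  rw [rotor_I_smul_pauliX, Matrix.det_fin_two_of]
  linear_combination h - (Real.sin θ : ℂ) ^ 2 * Complex.I_sq

/-- Euler angles in `SU(2)`. -/
theorem exists_euler_angles {A : Matrix (Fin 2) (Fin 2) ℂ} (hA : A ∈ Matrix.unitaryGroup (Fin 2) ℂ)
    (hdet : A.det = 1) :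
    ∃ α β γ : ℝ, A = rotor (Complex.I • pauliZ) α * rotor (Complex.I • pauliX) β
      * rotor (Complex.I • pauliZ) γ := by
  -- With determinant one, the adjugate and the adjoint are both the inverse; comparing entries
  -- determines the second row from the first.
  have hadj : A.adjugate = star A := by
    have h1 : A * A.adjugate = 1 := by rw [Matrix.mul_adjugate, hdet, one_smul]
    calc A.adjugate = star A * A * A.adjugate := by
          rw [Matrix.mem_unitaryGroup_iff'.1 hA, one_mul]
      _ = star A := by rw [mul_assoc, h1, mul_one]
  rw [Matrix.adjugate_fin_two] at hadj
  have h11 : A 1 1 = star (A 0 0) := by simpa using congrFun (congrFun hadj 0) 0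
  have h10 : -(A 1 0) = star (A 0 1) := by simpa using congrFun (congrFun hadj 1) 0
  obtain ⟨a, ha⟩ : ∃ a, A 0 0 = a := ⟨_, rfl⟩
  -- The factor `i` is split off to match the off-diagonal entry `i sin β` of the `X` rotor.
  obtain ⟨b, hb⟩ : ∃ b, A 0 1 = Complex.I * b := ⟨-(Complex.I * A 0 1), by
    linear_combination (A 0 1) * Complex.I_sq⟩
  rw [ha] at h11
  have h10' : A 1 0 = Complex.I * star b := by
    rw [← neg_neg (A 1 0), h10, hb, star_mul', Complex.star_def, Complex.conj_I]
    ring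
  have hn : (‖a‖ : ℝ) ^ 2 + ‖b‖ ^ 2 = 1 := by
    rw [Matrix.det_fin_two, ha, h11, h10', hb] at hdet
    have : ((‖a‖ ^ 2 + ‖b‖ ^ 2 : ℝ) : ℂ) = 1 := by
      push_cast
      rw [← Complex.mul_conj', ← Complex.mul_conj', ← hdet, Complex.star_def]
      linear_combination (b * (starRingEnd ℂ) b) * Complex.I_sq
    exact_mod_cast this
  obtain ⟨β, hcos, hsin⟩ : ∃ β, Real.cos β = ‖a‖ ∧ Real.sin β = ‖b‖ := by
    have hw : ‖(⟨‖a‖, ‖b‖⟩ : ℂ)‖ = 1 := by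
      rw [Complex.norm_def, Complex.normSq_mk, ← sq, ← sq, hn, Real.sqrt_one]
    have h1 := Complex.norm_mul_cos_arg ⟨‖a‖, ‖b‖⟩
    have h2 := Complex.norm_mul_sin_arg ⟨‖a‖, ‖b‖⟩
    rw [hw, one_mul] at h1 h2
    exact ⟨_, h1, h2⟩
  -- The outer `Z` rotors multiply diagonal entries by phases of angle `±(α + γ)` and off-diagonal
  -- ones by `±(α - γ)`.
  obtain ⟨α, γ, hαγ, hαγ'⟩ : ∃ α γ : ℝ, a.arg = α + γ ∧ b.arg = α - γ :=
    ⟨(a.arg + b.arg) / 2, (a.arg - b.arg) / 2, by ring, by ring⟩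
  have hconj : ∀ z : ℂ, star z = ‖z‖ * Complex.exp (-(z.arg * Complex.I)) := fun z => by
    conv_lhs => rw [← Complex.norm_mul_exp_arg_mul_I z]
    rw [Complex.star_def, map_mul, Complex.conj_ofReal, ← Complex.exp_conj, map_mul,
      Complex.conj_I, Complex.conj_ofReal, mul_neg]
  have e00 : Complex.exp (α * Complex.I) * ‖a‖ * Complex.exp (γ * Complex.I) = a := by
    conv_rhs => rw [← Complex.norm_mul_exp_arg_mul_I a]
    rw [hαγ, Complex.ofReal_add, add_mul, Complex.exp_add]
    ring
  have e01 : Complex.exp (α * Complex.I) * (‖b‖ * Complex.I) * Complex.exp (-(γ * Complex.I))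
      = Complex.I * b := by
    conv_rhs => rw [← Complex.norm_mul_exp_arg_mul_I b]
    rw [hαγ', Complex.ofReal_sub, sub_mul, sub_eq_add_neg, Complex.exp_add]
    ring
  have e10 : Complex.exp (-(α * Complex.I)) * (‖b‖ * Complex.I) * Complex.exp (γ * Complex.I)
      = Complex.I * star b := by
    rw [hconj, hαγ', Complex.ofReal_sub, sub_mul, neg_sub, sub_eq_neg_add, Complex.exp_add]
    ring
  have e11 : Complex.exp (-(α * Complex.I)) * ‖a‖ * Complex.exp (-(γ * Complex.I)) = star a := by
    rw [hconj, hαγ, Complex.ofReal_add, add_mul, neg_add, Complex.exp_add]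
    ring
  refine ⟨α, β, γ, ?_⟩
  rw [rotor_I_smul_pauliZ, rotor_I_smul_pauliZ, rotor_I_smul_pauliX, hcos, hsin,
    Matrix.mul_fin_two, Matrix.mul_fin_two, Matrix.eta_fin_two A, ha, hb, h10', h11]
  simp only [mul_zero, zero_mul, add_zero, zero_add, e00, e01, e10, e11]

end SU2

/-! ### Normalised matchgates and adjacent plane rotations generate the same group. -/

section Generation

variable {n : ℕ}

theorem givensGates_subset_nnSpecialMatchgates (hn : 2 ≤ n) :
    givensGates n ⊆ nnSpecialMatchgates n := by
  rintro _ ⟨l, m, h, hlm, θ, rfl⟩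
  have hl := l.2
  have hm := m.2
  rcases Nat.even_or_odd' (l : ℕ) with ⟨k, hk | hk⟩
  · by_cases hkn : k + 1 < n
    · have hij : (⟨k, by omega⟩ : Fin n) ≠ ⟨k + 1, hkn⟩ := by simp
      refine ⟨⟨k, by omega⟩, ⟨k + 1, hkn⟩, rfl, _, rotor_I_smul_pauliZ_mem θ, _,
        rotor_I_smul_pauliZ_mem θ, det_rotor_I_smul_pauliZ θ, det_rotor_I_smul_pauliZ θ, ?_⟩
      rw [onPair_gateMatrix_rotor hij, onPair_ZI hij, coe_givensUnitary,
        majorana_mul_succ_of_even (i := ⟨k, by omega⟩) hk (by simp; omega)]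
    -- The last qubit has no right neighbour, so its `Z` rotation is placed in the second slot of
    -- the last pair, where `B` gets the opposite angle.
    · have hij : (⟨k - 1, by omega⟩ : Fin n) ≠ ⟨k, by omega⟩ := by simp; omega
      refine ⟨⟨k - 1, by omega⟩, ⟨k, by omega⟩, by simp; omega, _, rotor_I_smul_pauliZ_mem θ, _,
        rotor_I_smul_pauliZ_mem (-θ), det_rotor_I_smul_pauliZ θ, det_rotor_I_smul_pauliZ (-θ), ?_⟩
      rw [← rotor_neg, onPair_gateMatrix_rotor hij, onPair_IZ hij, coe_givensUnitary,
        majorana_mul_succ_of_even (i := ⟨k, by omega⟩) hk (by simp; omega)]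
  · have hij : (⟨k, by omega⟩ : Fin n) ≠ ⟨k + 1, by omega⟩ := by simp
    refine ⟨⟨k, by omega⟩, ⟨k + 1, by omega⟩, rfl, _, rotor_I_smul_pauliX_mem θ, _,
      rotor_I_smul_pauliX_mem θ, det_rotor_I_smul_pauliX θ, det_rotor_I_smul_pauliX θ, ?_⟩
    rw [onPair_gateMatrix_rotor hij, onPair_XX hij, coe_givensUnitary,
      majorana_mul_succ_of_odd (i := ⟨k, by omega⟩) (j := ⟨k + 1, by omega⟩) hk
        (by simp; omega) rfl]

/-- The matchgate `G(A, B)` on the qubits `i`, `j` is a product of adjacent plane rotations. -/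
def IsGivensProduct (i j : Fin n) (A B : Matrix (Fin 2) (Fin 2) ℂ) : Prop :=
  ∃ U ∈ Subgroup.closure (givensGates n), (U : Op n) = onPair i j (gateMatrix A B)

theorem IsGivensProduct.mul {i j : Fin n} (hij : i ≠ j) {A B C D : Matrix (Fin 2) (Fin 2) ℂ}
    (h : IsGivensProduct i j A B) (h' : IsGivensProduct i j C D) :
    IsGivensProduct i j (A * C) (B * D) := by
  obtain ⟨U, hU, eU⟩ := h
  obtain ⟨V, hV, eV⟩ := h'
  exact ⟨U * V, mul_mem hU hV, by
    rw [Matrix.UnitaryGroup.mul_val, eU, eV, ← onPair_mul hij, gateMatrix_mul]⟩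

theorem isGivensProduct_of_rotor {i j : Fin n} (hij : i ≠ j) {l m : Fin (2 * n)}
    (hlm : (m : ℕ) = l + 1) {E F : Matrix (Fin 2) (Fin 2) ℂ}
    (h : (majorana l * majorana m : Op n) = onPair i j (gateMatrix E F)) (θ : ℝ) :
    IsGivensProduct i j (rotor E θ) (rotor F θ) := by
  have hne : l ≠ m := fun e => by subst e; omega
  exact ⟨givensUnitary hne θ, Subgroup.subset_closure ⟨l, m, hne, hlm, θ, rfl⟩, by
    rw [onPair_gateMatrix_rotor hij, ← h, coe_givensUnitary]⟩

/-- `Z` on the first qubit gives equal angles in the two blocks and `Z` on the second opposite ones;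
half-sum and half-difference reach every pair. -/
theorem isGivensProduct_pauliZ {i j : Fin n} (hij : (j : ℕ) = i + 1) (α β : ℝ) :
    IsGivensProduct i j (rotor (Complex.I • pauliZ) α) (rotor (Complex.I • pauliZ) β) := by
  have hne : i ≠ j := fun e => by subst e; omega
  have hi := i.2
  have hj := j.2
  have h1 := isGivensProduct_of_rotor hne (l := ⟨2 * i, by omega⟩) (m := ⟨2 * i + 1, by omega⟩) rfl
    ((majorana_mul_succ_of_even rfl rfl).trans (onPair_ZI hne).symm) ((α + β) / 2)
  have h2 := isGivensProduct_of_rotor hne (l := ⟨2 * j, by omega⟩) (m := ⟨2 * j + 1, by omega⟩) rfl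
    ((majorana_mul_succ_of_even rfl rfl).trans (onPair_IZ hne).symm) ((α - β) / 2)
  have := h1.mul hne h2
  rw [rotor_neg, rotor_mul_rotor I_smul_pauliZ_mul_self, rotor_mul_rotor I_smul_pauliZ_mul_self]
    at this
  convert this using 2 <;> ring

/-- The available `X ⊗ X` rotation has equal angles in both blocks. Conjugating by `iZ` in the `A`
block alone reverses the angle there, which supplies the opposite angles. -/
theorem isGivensProduct_pauliX {i j : Fin n} (hij : (j : ℕ) = i + 1) (α β : ℝ) :
    IsGivensProduct i j (rotor (Complex.I • pauliX) α) (rotor (Complex.I • pauliX) β) := by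
  have hne : i ≠ j := fun e => by subst e; omega
  have hi := i.2
  have hj := j.2
  have hXX : ∀ θ : ℝ, IsGivensProduct i j (rotor (Complex.I • pauliX) θ)
      (rotor (Complex.I • pauliX) θ) := fun θ =>
    isGivensProduct_of_rotor hne (l := ⟨2 * i + 1, by omega⟩) (m := ⟨2 * i + 2, by omega⟩) rfl
      ((majorana_mul_succ_of_odd rfl rfl hij).trans (onPair_XX hne).symm) θ
  have hflip : ∀ θ : ℝ, rotor (Complex.I • pauliZ) (Real.pi / 2) * rotor (Complex.I • pauliX) θ
      * rotor (Complex.I • pauliZ) (-(Real.pi / 2)) = rotor (Complex.I • pauliX) (-θ) := fun θ => by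
    have h1 : rotor (Complex.I • pauliZ) (Real.pi / 2) = Complex.I • pauliZ := by simp [rotor]
    have h2 : rotor (Complex.I • pauliZ) (-(Real.pi / 2)) = -(Complex.I • pauliZ) := by
      simp [rotor]
    rw [h1, h2, ← rotor_neg, rotor, rotor]
    simp only [mul_add, add_mul, Matrix.mul_smul, Matrix.smul_mul, mul_neg, mul_one, smul_smul,
      pauliZ_mul_self, mul_assoc pauliZ, pauliX_mul_pauliZ, smul_neg]
    rw [← mul_assoc pauliZ, pauliZ_mul_self, one_mul]
    match_scalars
    · linear_combination (-Complex.cos θ) * Complex.I_sq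
    · linear_combination (Complex.I * Complex.sin θ) * Complex.I_sq
  have h1 := ((isGivensProduct_pauliZ hij (Real.pi / 2) 0).mul hne (hXX ((β - α) / 2))).mul hne
    (isGivensProduct_pauliZ hij (-(Real.pi / 2)) 0)
  rw [hflip, rotor_zero, one_mul, mul_one] at h1
  have := (hXX ((α + β) / 2)).mul hne h1
  rw [rotor_mul_rotor I_smul_pauliX_mul_self, rotor_mul_rotor I_smul_pauliX_mul_self] at this
  convert this using 2 <;> ring

theorem nnSpecialMatchgates_subset_closure_givensGates :
    nnSpecialMatchgates n ⊆ Subgroup.closure (givensGates n) := by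
  rintro U ⟨i, j, hij, A, hA, B, hB, dA, dB, hU⟩
  have hne : i ≠ j := fun e => by subst e; omega
  obtain ⟨α, β, γ, rfl⟩ := exists_euler_angles hA dA
  obtain ⟨α', β', γ', rfl⟩ := exists_euler_angles hB dB
  obtain ⟨V, hV, eV⟩ := ((isGivensProduct_pauliZ hij α α').mul hne
    (isGivensProduct_pauliX hij β β')).mul hne (isGivensProduct_pauliZ hij γ γ')
  rwa [show U = V from Subtype.ext (hU.trans eV.symm)]

theorem specialMatchgateGroup_eq_closure_givensGates (hn : 2 ≤ n) :
    specialMatchgateGroup n = Subgroup.closure (givensGates n) :=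
  le_antisymm ((Subgroup.closure_le _).2 nnSpecialMatchgates_subset_closure_givensGates)
    (Subgroup.closure_mono (givensGates_subset_nnSpecialMatchgates hn))

end Generation

/-! ### The commutant of the Majorana operators is scalar. -/

section Commutant

variable {n : ℕ}

theorem tensorOp_Z_eq_diagonal (k : Fin n) :
    (tensorOp fun j => if j = k then Complex.I • pauliZ else 1)
      = Matrix.diagonal fun x : Fin n → Fin 2 => Complex.I * pauliZ (x k) (x k) := by
  ext x y
  rw [Matrix.diagonal_apply]
  simp only [tensorOp, Matrix.of_apply]
  split_ifs with h
  · subst h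
    rw [Finset.prod_eq_single k]
    · simp
    · intro j _ hj
      simp [hj]
    · simp
  · obtain ⟨j, hj⟩ := Function.ne_iff.mp h
    refine Finset.prod_eq_zero (Finset.mem_univ j) ?_
    split_ifs
    · generalize x j = a at hj ⊢
      generalize y j = b at hj ⊢
      fin_cases a <;> fin_cases b <;> simp_all [pauliZ]
    · exact Matrix.one_apply_ne hj

/-- The Majorana operators generate the full matrix algebra, so their commutant is trivial. -/
theorem exists_eq_smul_one_of_commute {M : Op n}
    (h : ∀ l : Fin (2 * n), M * majorana l = majorana l * M) : ∃ z : ℂ, M = z • (1 : Op n) := by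
  -- Commuting with `iZ` on a qubit where `x` and `y` differ kills the entry, since its eigenvalues
  -- there are distinct.
  have hoff : ∀ x y, x ≠ y → M x y = 0 := by
    intro x y hxy
    obtain ⟨k, hk⟩ := Function.ne_iff.mp hxy
    have hk2 := k.2
    have e : M * (majorana (⟨2 * k, by omega⟩ : Fin (2 * n)) * majorana ⟨2 * k + 1, by omega⟩)
        = majorana ⟨2 * k, by omega⟩ * majorana ⟨2 * k + 1, by omega⟩ * M := by
      rw [← mul_assoc, h, mul_assoc, h, mul_assoc]
    rw [majorana_mul_succ_of_even rfl rfl, tensorOp_Z_eq_diagonal] at e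
    have := congrFun (congrFun e x) y
    rw [Matrix.mul_diagonal, Matrix.diagonal_mul] at this
    generalize M x y = u at this ⊢
    generalize x k = a at hk this
    generalize y k = b at hk this
    have h2 : Complex.I * u = 0 → u = 0 := fun h0 => by simpa using h0
    fin_cases a <;> fin_cases b
    · exact absurd rfl hk
    · simp only [pauliZ] at this
      apply h2
      norm_num at this
      linear_combination (-1 / 2) * this
    · simp only [pauliZ] at this
      apply h2
      norm_num at this
      linear_combination (1 / 2) * this
    · exact absurd rfl hk
  have hM : M = Matrix.diagonal fun x => M x x := by
    ext x y
    rw [Matrix.diagonal_apply]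
    split_ifs with hxy
    · rw [hxy]
    · exact hoff x y hxy
  -- The operator of index `2k` flips bit `k` with a nonzero coefficient, so commuting with it makes
  -- the diagonal invariant under that flip.
  have hflip : ∀ x (k : Fin n) (b : Fin 2), M (Function.update x k b) (Function.update x k b)
      = M x x := by
    intro x k b
    by_cases hb : b = x k
    · rw [hb, Function.update_eq_self]
    have hk2 := k.2
    have e := congrFun (congrFun (h ⟨2 * k, by omega⟩) x) (Function.update x k b)
    rw [hM, Matrix.diagonal_mul, Matrix.mul_diagonal, mul_comm] at e
    refine (mul_left_cancel₀ ?_ e).symm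
    simp only [majorana, tensorOp, Matrix.of_apply]
    refine Finset.prod_ne_zero_iff.2 fun j _ => ?_
    have h1 : 2 * (k : ℕ) / 2 = k := by omega
    have h2 : 2 * (k : ℕ) % 2 = 0 := by omega
    simp only [h1, h2, if_true]
    by_cases hj : j = k
    · subst hj
      rw [if_neg (lt_irrefl _), if_pos rfl, Function.update_self]
      have hX : ∀ a b : Fin 2, b ≠ a → pauliX a b ≠ 0 := by
        intro a b
        fin_cases a <;> fin_cases b <;> simp [pauliX]
      exact hX _ _ hb
    · have hj' : (j : ℕ) ≠ k := fun e => hj (Fin.ext e)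
      rw [Function.update_of_ne hj, if_neg hj']
      split_ifs
      · generalize x j = a
        fin_cases a <;> simp [pauliZ]
      · simp
  have hconst : ∀ x y : Fin n → Fin 2, M x x = M y y := by
    intro x y
    have : ∀ s : Finset (Fin n), M (s.piecewise x y) (s.piecewise x y) = M y y := by
      intro s
      induction s using Finset.induction_on with
      | empty => simp
      | insert j s _ ih => rw [Finset.piecewise_insert, hflip, ih]
    simpa using this Finset.univ
  refine ⟨M 0 0, ?_⟩
  ext x y
  rw [Matrix.smul_apply, Matrix.one_apply]
  split_ifs with hxy
  · rw [hxy, hconst y 0, smul_eq_mul, mul_one]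
  · rw [hoff x y hxy, smul_zero]

theorem exists_eq_smul_one_of_actsBy_one {U : QubitUnitary n} (h : ActsBy U 1) :
    ∃ z : ℂ, (U : Op n) = z • (1 : Op n) := by
  refine exists_eq_smul_one_of_commute fun l => commute_of_conj_eq ?_
  rw [h.conj_majorana, one_row, majoranaSum_single]

end Commutant

/-! ### Bookkeeping for gate counts. -/

section Products

variable {n : ℕ} {S T : Set (QubitUnitary n)} {N M : ℕ} {U V : QubitUnitary n}

theorem IsProductOfAtMost.mono (h : IsProductOfAtMost S N U) (hST : S ⊆ T) (hNM : N ≤ M) :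
    IsProductOfAtMost T M U := by
  obtain ⟨L, h1, h2, h3⟩ := h
  exact ⟨L, fun g hg => hST (h1 g hg), h2.trans hNM, h3⟩

theorem isProductOfAtMost_one : IsProductOfAtMost S N 1 := ⟨[], by simp, by simp, rfl⟩

theorem isProductOfAtMost_of_mem (h : U ∈ S) : IsProductOfAtMost S 1 U :=
  ⟨[U], by simpa using h, by simp, by simp⟩

theorem IsProductOfAtMost.mul (hU : IsProductOfAtMost S N U) (hV : IsProductOfAtMost S M V) :
    IsProductOfAtMost S (N + M) (U * V) := by
  obtain ⟨L, h1, h2, rfl⟩ := hU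
  obtain ⟨K, k1, k2, rfl⟩ := hV
  refine ⟨L ++ K, fun g hg => ?_, by rw [List.length_append]; omega, List.prod_append⟩
  rcases List.mem_append.1 hg with hg | hg
  exacts [h1 g hg, k1 g hg]

theorem IsProductOfAtMost.inv (hS : ∀ g ∈ S, g⁻¹ ∈ S) (h : IsProductOfAtMost S N U) :
    IsProductOfAtMost S N U⁻¹ := by
  obtain ⟨L, h1, h2, rfl⟩ := h
  refine ⟨(L.map fun g => g⁻¹).reverse, fun g hg => ?_, by simpa using h2,
    (List.prod_inv_reverse L).symm⟩
  simp only [List.mem_reverse, List.mem_map] at hg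
  obtain ⟨g', hg', rfl⟩ := hg
  exact hS _ (h1 _ hg')

theorem IsProductOfAtMost.mem_closure (h : IsProductOfAtMost S N U) : U ∈ Subgroup.closure S := by
  obtain ⟨L, h1, -, rfl⟩ := h
  exact list_prod_mem fun g hg => Subgroup.subset_closure (h1 g hg)

theorem inv_mem_givensGates : ∀ g ∈ givensGates n, g⁻¹ ∈ givensGates n := by
  rintro _ ⟨l, m, h, hlm, θ, rfl⟩
  refine ⟨l, m, h, hlm, -θ, ?_⟩
  rw [inv_eq_iff_mul_eq_one, givensUnitary_mul, add_neg_cancel]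
  exact Subtype.ext (rotor_zero _)

end Products

/-! ### Givens elimination in `SO(2n)`. -/

section Reduction

variable {n : ℕ}

theorem exists_givens_rotation {l m : Fin (2 * n)} (h : l ≠ m) (v : Fin (2 * n) → ℝ) :
    ∃ θ : ℝ, ∃ w : Fin (2 * n) → ℝ, (givensUnitary h θ : Op n) * majoranaSum v
      * (givensUnitary h θ : Op n).conjTranspose = majoranaSum w ∧ w m = 0 ∧ 0 ≤ w l ∧
      ∀ k, k ≠ l → k ≠ m → w k = v k := by
  have h1 := Complex.norm_mul_cos_arg ⟨v l, v m⟩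
  have h2 := Complex.norm_mul_sin_arg ⟨v l, v m⟩
  dsimp only at h1 h2
  -- Rotating by the polar angle of `(v l, v m)` moves that pair to `(r, 0)` with `r ≥ 0`; it is
  -- halved because conjugation doubles angles.
  refine ⟨Complex.arg ⟨v l, v m⟩ / 2, _, (actsBy_givensUnitary h _).conj_majoranaSum v, ?_, ?_, ?_⟩
  · rw [vecMul_planeRotation, mul_div_cancel₀ _ two_ne_zero]
    generalize Complex.arg ⟨v l, v m⟩ = φ at *
    generalize ‖(⟨v l, v m⟩ : ℂ)‖ = r at *
    simp [Pi.single_eq_of_ne h.symm]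
    linear_combination Real.sin φ * h1 - Real.cos φ * h2
  · rw [vecMul_planeRotation, mul_div_cancel₀ _ two_ne_zero]
    have hr := norm_nonneg (⟨v l, v m⟩ : ℂ)
    generalize Complex.arg ⟨v l, v m⟩ = φ at *
    generalize ‖(⟨v l, v m⟩ : ℂ)‖ = r at *
    simp [Pi.single_eq_of_ne h]
    have h3 := Real.cos_sq_add_sin_sq φ
    have : v l + v l * (Real.cos φ - 1) + v m * Real.sin φ = r := by
      rw [← h1, ← h2]
      linear_combination r * h3
    rwa [this]
  · intro k hl hm
    rw [vecMul_planeRotation]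
    simp [hl, hm]

/-- Adjacent plane rotations move a vector supported on the first `k + d + 2` coordinates to one
supported on the first `k + 1`, without touching the coordinates below `k`. -/
theorem exists_product_clearing (k d : ℕ) (hd : k + d + 1 < 2 * n) (v : Fin (2 * n) → ℝ)
    (hv : ∀ j : Fin (2 * n), k + d + 1 < j → v j = 0) :
    ∃ V : QubitUnitary n, IsProductOfAtMost (givensGates n) (d + 1) V ∧
      (∀ l : Fin (2 * n), (l : ℕ) < k →
        (V : Op n) * majorana l * (V : Op n).conjTranspose = majorana l) ∧
      ∃ w : Fin (2 * n) → ℝ,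
        (V : Op n) * majoranaSum v * (V : Op n).conjTranspose = majoranaSum w ∧
        (∀ j : Fin (2 * n), k < j → w j = 0) ∧ 0 ≤ w ⟨k, by omega⟩ := by
  induction d generalizing v with
  | zero =>
    have h : (⟨k, by omega⟩ : Fin (2 * n)) ≠ ⟨k + 1, hd⟩ := by simp
    obtain ⟨θ, w, h1, h2, h3, h4⟩ := exists_givens_rotation h v
    refine ⟨givensUnitary h θ, isProductOfAtMost_of_mem ⟨_, _, h, rfl, θ, rfl⟩, fun l hl => ?_,
      w, h1, fun j hj => ?_, h3⟩
    · exact givensUnitary_conj_of_ne h θ (fun e => by simp [e] at hl) (fun e => by simp [e] at hl)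
    · by_cases e : (j : ℕ) = k + 1
      · rw [show j = ⟨k + 1, hd⟩ from Fin.ext e, h2]
      · rw [h4 j (fun e' => by simp [e'] at hj) (fun e' => e (by simp [e']))]
        exact hv j (by omega)
  | succ d ih =>
    have h : (⟨k + d + 1, by omega⟩ : Fin (2 * n)) ≠ ⟨k + d + 1 + 1, hd⟩ := by simp
    -- The last coordinate is cleared into its left neighbour. Nonnegativity matters only for the
    -- final rotation, so it is discarded here.
    obtain ⟨θ, w, h1, h2, -, h4⟩ := exists_givens_rotation h v
    obtain ⟨V, hV, hfix, u, hu, hu0, hu1⟩ := ih (by omega) w fun j hj => by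
      by_cases e : (j : ℕ) = k + d + 1 + 1
      · rw [show j = ⟨k + d + 1 + 1, hd⟩ from Fin.ext e, h2]
      · rw [h4 j (fun e' => by simp [e'] at hj) (fun e' => e (by simp [e']))]
        exact hv j (by omega)
    have hconj : ∀ M : Op n, ((V * givensUnitary h θ : QubitUnitary n) : Op n) * M
        * ((V * givensUnitary h θ : QubitUnitary n) : Op n).conjTranspose
        = (V : Op n) * ((givensUnitary h θ : Op n) * M * (givensUnitary h θ : Op n).conjTranspose)
          * (V : Op n).conjTranspose := fun M => by
      rw [Matrix.UnitaryGroup.mul_val, Matrix.conjTranspose_mul]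
      simp only [mul_assoc]
    refine ⟨V * givensUnitary h θ, hV.mul (isProductOfAtMost_of_mem ⟨_, _, h, rfl, θ, rfl⟩),
      fun l hl => ?_, u, ?_, hu0, hu1⟩
    · rw [hconj, givensUnitary_conj_of_ne h θ (fun e => by simp [e] at hl; omega)
        (fun e => by simp [e] at hl; omega), hfix l hl]
    · rw [hconj, h1, hu]

/-- If a row of an orthogonal matrix is standard, the other entries of that column vanish. -/
theorem apply_eq_zero_of_row_eq_single {R : Matrix (Fin (2 * n)) (Fin (2 * n)) ℝ}
    (h : R * R.transpose = 1) {k l : Fin (2 * n)} (hkl : k ≠ l) (hl : R l = Pi.single l 1) :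
    R k l = 0 := by
  have := congrFun (congrFun h k) l
  rw [Matrix.one_apply_ne hkl, Matrix.mul_apply'] at this
  change R k ⬝ᵥ R l = 0 at this
  rwa [hl, dotProduct_single_one] at this

/-- A proper rotation fixing the first `k` basis vectors is implemented by a short product of
adjacent plane rotations. -/
theorem exists_product_of_fixes (d k : ℕ) (hd : k + d + 1 = 2 * n)
    (R : Matrix (Fin (2 * n)) (Fin (2 * n)) ℝ) (hR : R * R.transpose = 1) (hdet : R.det = 1)
    (hrow : ∀ l : Fin (2 * n), (l : ℕ) < k → R l = Pi.single l 1) :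
    ∃ V : QubitUnitary n, IsProductOfAtMost (givensGates n) (d * (2 * n - 1)) V ∧ ActsBy V R := by
  induction d generalizing k R with
  | zero =>
    have hdiag : R = Matrix.diagonal fun l => R l l := by
      ext l m
      rw [Matrix.diagonal_apply]
      split_ifs with e
      · rw [e]
      · by_cases hl : (l : ℕ) < k
        · rw [hrow l hl, Pi.single_eq_of_ne (Ne.symm e)]
        · have : (l : ℕ) ≠ m := fun e' => e (Fin.ext e')
          exact apply_eq_zero_of_row_eq_single hR e (hrow m (by omega))
    -- Only the last diagonal entry is still free, and the determinant forces it to be one; no gate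
    -- is needed for the last row.
    have hone : R = 1 := by
      rw [hdiag, Matrix.det_diagonal, Finset.prod_eq_single ⟨k, by omega⟩] at hdet
      · rw [hdiag, ← Matrix.diagonal_one]
        congr 1
        funext l
        by_cases hl : (l : ℕ) < k
        · rw [hrow l hl, Pi.single_eq_same]
        · rw [show l = ⟨k, by omega⟩ from Fin.ext (by simp; omega), hdet]
      · intro l _ hl
        have : (l : ℕ) ≠ k := fun e => hl (Fin.ext e)
        rw [hrow l (by omega), Pi.single_eq_same]
      · simp
    exact ⟨1, isProductOfAtMost_one, hone ▸ actsBy_one⟩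
  | succ d ih =>
    obtain ⟨V, hV, hVfix, w, hw, hw0, hw1⟩ := exists_product_clearing k d (by omega)
      (R ⟨k, by omega⟩) fun j hj => by omega
    obtain ⟨T, hT, dT⟩ := actsAsProperRotation_iff.1
      (mem_rotationGroup.1 (closure_givensGates_le_rotationGroup hV.mem_closure))
    have hrow' : ∀ l : Fin (2 * n), (l : ℕ) < k → (R * T) l = Pi.single l 1 := fun l hl => by
      rw [Matrix.mul_apply_eq_vecMul, hrow l hl]
      apply majoranaSum_injective
      rw [← hT.conj_majoranaSum, majoranaSum_single, hVfix l hl]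
    have hk : (R * T) ⟨k, by omega⟩ = w := by
      rw [Matrix.mul_apply_eq_vecMul]
      apply majoranaSum_injective
      rw [← hT.conj_majoranaSum, hw]
    have hRT : (R * T) * (R * T).transpose = 1 := by
      rw [Matrix.transpose_mul, mul_assoc, ← mul_assoc T, hT.mul_transpose, one_mul, hR]
    -- Entries after `k` were cleared by the gates; those before `k` vanish by orthogonality to the
    -- standard rows.
    have hwk : w = w ⟨k, by omega⟩ • Pi.single ⟨k, by omega⟩ 1 := by
      funext j
      rw [Pi.smul_apply, smul_eq_mul]
      rcases lt_trichotomy (j : ℕ) k with h | h | h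
      · have hne : (⟨k, by omega⟩ : Fin (2 * n)) ≠ j := fun e => by rw [← e] at h; simp at h
        rw [Pi.single_eq_of_ne hne.symm, mul_zero, ← hk]
        exact apply_eq_zero_of_row_eq_single hRT hne (hrow' j h)
      · rw [show j = ⟨k, by omega⟩ from Fin.ext h, Pi.single_eq_same, mul_one]
      · have hne : j ≠ (⟨k, by omega⟩ : Fin (2 * n)) := fun e => by rw [e] at h; simp at h
        rw [Pi.single_eq_of_ne hne, mul_zero, hw0 j h]
    -- The row is a unit vector, and nonnegativity excludes `-1`.
    have hw1' : w ⟨k, by omega⟩ = 1 := by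
      have e := congrFun (congrFun hRT ⟨k, by omega⟩) ⟨k, by omega⟩
      rw [Matrix.one_apply_eq, Matrix.mul_apply'] at e
      change (R * T) ⟨k, by omega⟩ ⬝ᵥ (R * T) ⟨k, by omega⟩ = 1 at e
      rw [hk, hwk, smul_dotProduct, dotProduct_smul, dotProduct_single_one, Pi.single_eq_same,
        smul_eq_mul, smul_eq_mul, mul_one] at e
      nlinarith
    obtain ⟨W, hW, hWact⟩ := ih (k + 1) (by omega) (R * T) hRT
      (by rw [Matrix.det_mul, hdet, dT, one_mul]) fun l hl => by
        by_cases h : (l : ℕ) < k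
        · exact hrow' l h
        · have hlk : l = ⟨k, by omega⟩ := Fin.ext (by simp; omega)
          rw [hlk, hk, hwk, hw1', one_smul]
    -- `W` acts by `R * T` and `V⁻¹` by the inverse of `T`; with the reversed order the product acts
    -- by `R`.
    refine ⟨V⁻¹ * W, ((hV.inv inv_mem_givensGates).mul hW).mono subset_rfl ?_, ?_⟩
    · rw [add_mul, one_mul]
      omega
    · have := hT.inv.mul hWact
      rwa [mul_assoc, hT.mul_transpose, mul_one] at this

theorem exists_product_actsBy (hn : 1 ≤ n) {R : Matrix (Fin (2 * n)) (Fin (2 * n)) ℝ}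
    (hR : R ∈ Matrix.specialOrthogonalGroup (Fin (2 * n)) ℝ) :
    ∃ V : QubitUnitary n,
      IsProductOfAtMost (givensGates n) ((2 * n - 1) * (2 * n - 1)) V ∧ ActsBy V R := by
  rw [Matrix.mem_specialOrthogonalGroup_iff, Matrix.mem_orthogonalGroup_iff] at hR
  exact exists_product_of_fixes (2 * n - 1) 0 (by omega) R hR.1 hR.2 fun l hl => by omega

/-- Two unitaries with the same action on the Majorana operators differ by a phase. -/
theorem ActsBy.exists_eq_smul {U V : QubitUnitary n} {R : Matrix (Fin (2 * n)) (Fin (2 * n)) ℝ}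
    (hU : ActsBy U R) (hV : ActsBy V R) : ∃ z : ℂ, (U : Op n) = z • (V : Op n) := by
  have h := hU.mul hV.inv
  rw [mul_eq_one_comm.1 hV.mul_transpose] at h
  obtain ⟨z, hz⟩ := exists_eq_smul_one_of_actsBy_one h
  refine ⟨z, ?_⟩
  rw [← one_mul (V : Op n), ← Matrix.smul_mul, ← hz, ← Matrix.UnitaryGroup.mul_val,
    inv_mul_cancel_right]

theorem exists_smul_product_of_mem_rotationGroup (hn : 1 ≤ n) {U : QubitUnitary n}
    (hU : U ∈ rotationGroup n) :
    ∃ z : ℂ, ∃ V : QubitUnitary n,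
      IsProductOfAtMost (givensGates n) ((2 * n - 1) * (2 * n - 1)) V ∧
      (U : Op n) = z • (V : Op n) := by
  obtain ⟨R, hR, h⟩ := mem_rotationGroup.1 hU
  obtain ⟨V, hV, hVR⟩ := exists_product_actsBy hn hR
  obtain ⟨z, hz⟩ := h.exists_eq_smul hVR
  exact ⟨z, V, hV, hz⟩

end Reduction

/-! ### An antiunitary symmetry that pins down the phase. -/

section RealStructure

variable {n : ℕ}

variable (n) in
/-- The operator `Y ⊗ X ⊗ Y ⊗ ⋯`, which intertwines every normalised matchgate with its complex
conjugate. -/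
def conjugator : Op n := tensorOp fun j => if (j : ℕ) % 2 = 0 then pauliY else pauliX

theorem conjugator_mul_self : conjugator n * conjugator n = 1 := by
  rw [conjugator, tensorOp_mul, ← tensorOp_one]
  congr 1
  funext j
  split_ifs
  exacts [pauliY_mul_self, pauliX_mul_self]

variable (n) in
/-- The unitaries that are real with respect to the antiunitary `conjugator` times complex
conjugation. -/
def realGroup : Subgroup (QubitUnitary n) where
  carrier := {U | (U : Op n) * conjugator n = conjugator n * (U : Op n).map (starRingEnd ℂ)}
  one_mem' := by simp
  mul_mem' := by
    intro U V hU hV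
    simp only [Set.mem_ofPred_eq] at hU hV ⊢
    rw [Matrix.UnitaryGroup.mul_val, mul_assoc, hV, ← mul_assoc, hU, mul_assoc, Matrix.map_mul]
  inv_mem' := by
    intro U hU
    simp only [Set.mem_ofPred_eq] at hU ⊢
    have h1 : (U : Op n).map (starRingEnd ℂ) * ((U⁻¹ : QubitUnitary n) : Op n).map (starRingEnd ℂ)
        = 1 := by
      rw [← Matrix.map_mul, ← Matrix.UnitaryGroup.mul_val, mul_inv_cancel,
        Matrix.UnitaryGroup.one_val]
      simp
    calc ((U⁻¹ : QubitUnitary n) : Op n) * conjugator n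
        = ((U⁻¹ : QubitUnitary n) : Op n) * (conjugator n * (U : Op n).map (starRingEnd ℂ))
          * ((U⁻¹ : QubitUnitary n) : Op n).map (starRingEnd ℂ) := by
            rw [mul_assoc, mul_assoc, h1, mul_one]
      _ = (((U⁻¹ : QubitUnitary n) : Op n) * (U : Op n)) * conjugator n
          * ((U⁻¹ : QubitUnitary n) : Op n).map (starRingEnd ℂ) := by
            rw [← hU]; simp only [mul_assoc]
      _ = _ := by
            rw [← Matrix.UnitaryGroup.mul_val, inv_mul_cancel, Matrix.UnitaryGroup.one_val, one_mul]

theorem mem_realGroup {U : QubitUnitary n} : U ∈ realGroup n ↔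
    (U : Op n) * conjugator n = conjugator n * (U : Op n).map (starRingEnd ℂ) := Iff.rfl

theorem tensorOp_mul_conjugator {P : Fin n → Matrix (Fin 2) (Fin 2) ℂ}
    (h : ∀ j : Fin n, P j * (if (j : ℕ) % 2 = 0 then pauliY else pauliX)
      = (if (j : ℕ) % 2 = 0 then pauliY else pauliX) * (P j).map (starRingEnd ℂ)) :
    tensorOp P * conjugator n = conjugator n * (tensorOp P).map (starRingEnd ℂ) := by
  have : (tensorOp P).map (starRingEnd ℂ) = tensorOp fun j => (P j).map (starRingEnd ℂ) :=
    map_star_tensorOp P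
  rw [this, conjugator, tensorOp_mul, tensorOp_mul]
  exact congrArg _ (funext h)

theorem I_smul_pauliZ_mul_pauliY : (Complex.I • pauliZ) * pauliY
    = pauliY * (Complex.I • pauliZ).map (starRingEnd ℂ) := by
  ext i j; fin_cases i <;> fin_cases j <;>
    simp [Matrix.mul_apply, pauliY, pauliZ]

theorem I_smul_pauliZ_mul_pauliX : (Complex.I • pauliZ) * pauliX
    = pauliX * (Complex.I • pauliZ).map (starRingEnd ℂ) := by
  ext i j; fin_cases i <;> fin_cases j <;>
    simp [Matrix.mul_apply, pauliX, pauliZ]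

theorem I_smul_pauliX_mul_pauliY : (Complex.I • pauliX) * pauliY
    = pauliY * (Complex.I • pauliX).map (starRingEnd ℂ) := by
  ext i j; fin_cases i <;> fin_cases j <;>
    simp [Matrix.mul_apply, pauliX, pauliY]

theorem map_pauliX : pauliX.map (starRingEnd ℂ) = pauliX := by
  ext i j; fin_cases i <;> fin_cases j <;> simp [pauliX]

theorem map_one_conj : (1 : Matrix (Fin 2) (Fin 2) ℂ).map (starRingEnd ℂ) = 1 := by simp

/-- The adjacent pairs of Majorana operators are real. -/
theorem majorana_pair_mul_conjugator {l m : Fin (2 * n)} (hlm : (m : ℕ) = l + 1) :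
    (majorana l * majorana m : Op n) * conjugator n
      = conjugator n * (majorana l * majorana m : Op n).map (starRingEnd ℂ) := by
  have hl := l.2
  have hm := m.2
  rcases Nat.even_or_odd' (l : ℕ) with ⟨k, hk | hk⟩
  · rw [majorana_mul_succ_of_even (i := ⟨k, by omega⟩) hk (by rw [hlm, hk])]
    refine tensorOp_mul_conjugator fun j => ?_
    split_ifs
    · exact I_smul_pauliZ_mul_pauliY
    · exact I_smul_pauliZ_mul_pauliX
    · rw [map_one_conj, one_mul, mul_one]
    · rw [map_one_conj, one_mul, mul_one]
  · obtain ⟨i, hi⟩ : ∃ i : Fin n, (i : ℕ) = k := ⟨⟨k, by omega⟩, rfl⟩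
    obtain ⟨j, hj⟩ : ∃ j : Fin n, (j : ℕ) = k + 1 := ⟨⟨k + 1, by omega⟩, rfl⟩
    have hij : i ≠ j := fun e => by rw [e] at hi; omega
    rw [majorana_mul_succ_of_odd (i := i) (j := j) (by rw [hk, hi]) (by rw [hlm, hk, hi])
      (by rw [hj, hi])]
    -- Of the two neighbouring sites one carries `Y` and the other `X` in `conjugator`. The
    -- intertwining holds for `iX` at a `Y` site and for `X` at an `X` site, so the scalar `i` is
    -- assigned to the `Y` site.
    by_cases hpar : k % 2 = 0
    · refine tensorOp_mul_conjugator fun t => ?_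
      by_cases h1 : t = i
      · rw [if_pos h1, h1, hi, if_pos hpar]
        exact I_smul_pauliX_mul_pauliY
      by_cases h2 : t = j
      · rw [if_neg h1, if_pos h2, h2, hj, if_neg (by omega), map_pauliX]
      · rw [if_neg h1, if_neg h2, map_one_conj, one_mul, mul_one]
    · rw [← onPair_XX hij, onPair_eq_tensorOp hij (P := pauliX) (Q := Complex.I • pauliX)]
      · refine tensorOp_mul_conjugator fun t => ?_
        by_cases h1 : t = i
        · rw [if_pos h1, h1, hi, if_neg hpar, map_pauliX]
        by_cases h2 : t = j
        · rw [if_neg h1, if_pos h2, h2, hj, if_pos (by omega)]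
          exact I_smul_pauliX_mul_pauliY
        · rw [if_neg h1, if_neg h2, map_one_conj, one_mul, mul_one]
      · intro a b c d
        fin_cases a <;> fin_cases b <;> fin_cases c <;> fin_cases d <;>
          simp [pairIndex, gateMatrix, pauliX]

theorem closure_givensGates_le_realGroup : Subgroup.closure (givensGates n) ≤ realGroup n := by
  rw [Subgroup.closure_le]
  rintro _ ⟨l, m, h, hlm, θ, rfl⟩
  change _ = _
  have e : (rotor (majorana l * majorana m : Op n) θ).map (starRingEnd ℂ)
      = (Real.cos θ : ℂ) • (1 : Op n)
        + (Real.sin θ : ℂ) • (majorana l * majorana m : Op n).map (starRingEnd ℂ) := by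
    ext x y
    simp only [rotor, Matrix.map_apply, Matrix.add_apply, Matrix.smul_apply, smul_eq_mul, map_add,
      map_mul, Complex.conj_ofReal, Matrix.one_apply]
    split_ifs <;> simp
  rw [coe_givensUnitary, e, rotor, add_mul, mul_add, Matrix.smul_mul, Matrix.smul_mul,
    majorana_pair_mul_conjugator hlm, Matrix.mul_smul, Matrix.mul_smul, one_mul, mul_one]

/-- The only real phases are the two signs. -/
theorem eq_one_or_neg_one_of_mem_realGroup {U : QubitUnitary n} (hU : U ∈ realGroup n) {z : ℂ}
    (hz : (U : Op n) = z • (1 : Op n)) : z = 1 ∨ z = -1 := by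
  rw [mem_realGroup, hz] at hU
  have e : (z • (1 : Op n)).map (starRingEnd ℂ) = (starRingEnd ℂ z) • (1 : Op n) := by
    ext x y
    simp only [Matrix.map_apply, Matrix.smul_apply, smul_eq_mul, map_mul, Matrix.one_apply]
    split_ifs <;> simp
  rw [e, Matrix.smul_mul, one_mul, Matrix.mul_smul, mul_one] at hU
  have h1 := congrArg (· * conjugator n) hU
  simp only [Matrix.smul_mul, conjugator_mul_self] at h1
  have h2 : z = starRingEnd ℂ z := smul_one_injective h1
  have h3 := norm_eq_one_of_smul (U := U) (V := 1) hz
  rw [Complex.star_def, ← h2] at h3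
  exact mul_self_eq_one_iff.1 h3

end RealStructure

/-! ### Identification of both matchgate groups. -/

section Groups

variable {n : ℕ}

theorem neg_one_mem_givensGates (hn : 1 ≤ n) :
    ∃ U ∈ givensGates n, (U : Op n) = (-1 : ℂ) • (1 : Op n) := by
  have h : (⟨0, by omega⟩ : Fin (2 * n)) ≠ ⟨1, by omega⟩ := by simp
  exact ⟨givensUnitary h Real.pi, ⟨_, _, h, rfl, _, rfl⟩, by simp [coe_givensUnitary, rotor]⟩

/-- Elimination gives `U = z V` with `V` real as well, so `z = ±1`; the extra gate pays for the
sign. -/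
theorem isProductOfAtMost_of_mem_rotationGroup_of_mem_realGroup (hn : 1 ≤ n) {U : QubitUnitary n}
    (hU : U ∈ rotationGroup n) (hU' : U ∈ realGroup n) :
    IsProductOfAtMost (givensGates n) ((2 * n - 1) * (2 * n - 1) + 1) U := by
  obtain ⟨z, V, hV, hz⟩ := exists_smul_product_of_mem_rotationGroup hn hU
  have hUV : ((U * V⁻¹ : QubitUnitary n) : Op n) = z • (1 : Op n) := by
    rw [Matrix.UnitaryGroup.mul_val, hz, Matrix.smul_mul, ← Matrix.UnitaryGroup.mul_val,
      mul_inv_cancel, Matrix.UnitaryGroup.one_val]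
  have hV' := closure_givensGates_le_realGroup hV.mem_closure
  rcases eq_one_or_neg_one_of_mem_realGroup (mul_mem hU' (inv_mem hV')) hUV with h | h
  · rw [show U = V from Subtype.ext (by rw [hz, h, one_smul])]
    exact hV.mono subset_rfl (Nat.le_succ _)
  · obtain ⟨W, hW, eW⟩ := neg_one_mem_givensGates hn
    have : U = V * W := Subtype.ext (by
      rw [hz, h, Matrix.UnitaryGroup.mul_val, eW, Matrix.mul_smul, mul_one])
    rw [this]
    exact hV.mul (isProductOfAtMost_of_mem hW)

theorem specialMatchgateGroup_eq (hn : 2 ≤ n) :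
    specialMatchgateGroup n = rotationGroup n ⊓ realGroup n := by
  rw [specialMatchgateGroup_eq_closure_givensGates hn]
  exact le_antisymm
    (le_inf closure_givensGates_le_rotationGroup closure_givensGates_le_realGroup)
    fun U hU => (isProductOfAtMost_of_mem_rotationGroup_of_mem_realGroup (by omega) hU.1
      hU.2).mem_closure

theorem smul_one_mem_unitaryGroup {ι : Type*} [Fintype ι] [DecidableEq ι] {z : ℂ}
    (hz : z * star z = 1) : z • (1 : Matrix ι ι ℂ) ∈ Matrix.unitaryGroup ι ℂ := by
  rw [Matrix.mem_unitaryGroup_iff, star_smul, star_one, Matrix.smul_mul, Matrix.mul_smul, one_mul,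
    smul_smul, hz, one_smul]

theorem phase_mem_nnMatchgates (hn : 2 ≤ n) {U : QubitUnitary n} {z : ℂ}
    (hU : (U : Op n) = z • (1 : Op n)) : U ∈ nnMatchgates n := by
  have hz := norm_eq_one_of_smul (U := U) (V := 1) hU
  have hij : (⟨0, by omega⟩ : Fin n) ≠ ⟨1, by omega⟩ := by simp
  refine ⟨⟨0, by omega⟩, ⟨1, by omega⟩, rfl, z • 1, smul_one_mem_unitaryGroup hz, z • 1,
    smul_one_mem_unitaryGroup hz, rfl, ?_⟩
  rw [gateMatrix_smul, gateMatrix_one, onPair_smul, onPair_one hij, hU]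

theorem nnSpecialMatchgates_subset : nnSpecialMatchgates n ⊆ nnMatchgates n := by
  rintro U ⟨i, j, hij, A, hA, B, hB, dA, dB, hU⟩
  exact ⟨i, j, hij, A, hA, B, hB, dA.trans dB.symm, hU⟩

/-- Every matchgate is a normalised matchgate up to a phase. -/
theorem nnMatchgates_subset_rotationGroup : nnMatchgates n ⊆ rotationGroup n := by
  rintro U ⟨i, j, hij, A, hA, B, hB, hdet, hU⟩
  -- Scaling a two-by-two block by `z` multiplies its determinant by `z²`, so a square root of the
  -- inverse determinant normalises both blocks at once.
  obtain ⟨z, hz⟩ := IsAlgClosed.exists_pow_nat_eq (k := ℂ) (starRingEnd ℂ A.det) (n := 2) (by simp)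
  have hdet1 : A.det * starRingEnd ℂ A.det = 1 := (Matrix.det_of_mem_unitary hA).2
  have hzn : z * star z = 1 := by
    have h1 : ‖A.det‖ = 1 := by
      rw [Complex.mul_conj'] at hdet1
      have : ‖A.det‖ ^ 2 = 1 := by exact_mod_cast hdet1
      exact (pow_eq_one_iff_of_nonneg (norm_nonneg _) two_ne_zero).1 this
    have h2 : ‖z‖ ^ 2 = 1 := by rw [← norm_pow, hz, Complex.norm_conj, h1]
    rw [Complex.star_def, Complex.mul_conj']
    exact_mod_cast h2
  have hzA : ∀ C ∈ Matrix.unitaryGroup (Fin 2) ℂ, z • C ∈ Matrix.unitaryGroup (Fin 2) ℂ := by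
    intro C hC
    have := mul_mem (smul_one_mem_unitaryGroup (ι := Fin 2) hzn) hC
    rwa [Matrix.smul_mul, one_mul] at this
  have hzU : z • (U : Op n) ∈ Matrix.unitaryGroup (Fin n → Fin 2) ℂ := by
    have := mul_mem (smul_one_mem_unitaryGroup (ι := Fin n → Fin 2) hzn) U.2
    rwa [Matrix.smul_mul, one_mul] at this
  have hV : (⟨z • (U : Op n), hzU⟩ : QubitUnitary n) ∈ nnSpecialMatchgates n := by
    refine ⟨i, j, hij, z • A, hzA A hA, z • B, hzA B hB, ?_, ?_, ?_⟩
    · rw [Matrix.det_smul, Fintype.card_fin, hz, mul_comm, hdet1]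
    · rw [Matrix.det_smul, Fintype.card_fin, hz, mul_comm, ← hdet, hdet1]
    · rw [gateMatrix_smul, onPair_smul, ← hU]
  obtain ⟨R, hR, hVR⟩ := closure_givensGates_le_rotationGroup
    (nnSpecialMatchgates_subset_closure_givensGates hV)
  refine ⟨R, hR, ActsBy.of_smul (z := star z) ?_ hVR⟩
  rw [smul_smul, mul_comm, hzn, one_smul]

theorem length_bound (hn : 2 ≤ n) : (2 * n - 1) * (2 * n - 1) + 1 ≤ 2 * n ^ 3 := by
  obtain ⟨k, rfl⟩ := Nat.exists_eq_add_of_le hn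
  rw [show 2 * (2 + k) - 1 = 2 * k + 3 by omega]
  nlinarith [Nat.zero_le k, Nat.zero_le (k ^ 2), Nat.zero_le (k ^ 3)]

theorem isProductOfAtMost_of_mem_rotationGroup (hn : 2 ≤ n) {U : QubitUnitary n}
    (hU : U ∈ rotationGroup n) : IsProductOfAtMost (nnMatchgates n) (2 * n ^ 3) U := by
  obtain ⟨z, V, hV, hz⟩ := exists_smul_product_of_mem_rotationGroup (by omega) hU
  have hUV : ((V⁻¹ * U : QubitUnitary n) : Op n) = z • (1 : Op n) := by
    rw [Matrix.UnitaryGroup.mul_val, hz, Matrix.mul_smul, ← Matrix.UnitaryGroup.mul_val,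
      inv_mul_cancel, Matrix.UnitaryGroup.one_val]
  have h := (hV.mono ((givensGates_subset_nnSpecialMatchgates hn).trans nnSpecialMatchgates_subset)
    le_rfl).mul (isProductOfAtMost_of_mem (phase_mem_nnMatchgates hn hUV))
  rw [mul_inv_cancel_left] at h
  exact h.mono subset_rfl (length_bound hn)

theorem matchgateGroup_eq (hn : 2 ≤ n) : matchgateGroup n = rotationGroup n :=
  le_antisymm ((Subgroup.closure_le _).2 nnMatchgates_subset_rotationGroup)
    fun _ hU => (isProductOfAtMost_of_mem_rotationGroup hn hU).mem_closure

end Groups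

/-! ### Closedness, compactness and the quotient by phases. -/

section Topology

variable {n : ℕ}

instance : CompactSpace (QubitUnitary n) := by
  refine isCompact_iff_compactSpace.1 ?_
  have hK : IsCompact (Set.pi Set.univ fun _ => Set.pi Set.univ fun _ => Metric.closedBall 0 1 :
      Set ((Fin n → Fin 2) → (Fin n → Fin 2) → ℂ)) :=
    isCompact_univ_pi fun _ => isCompact_univ_pi fun _ => isCompact_closedBall _ _
  refine hK.of_isClosed_subset (isClosed_unitary (R := Op n)) fun U hU i _ j _ => ?_
  rw [mem_closedBall_zero_iff]
  exact entry_norm_bound_of_unitary hU i j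

/-- The matrix by which `U` acts on the Majorana operators, when it does so. -/
noncomputable def rotationMatrix (U : QubitUnitary n) : Matrix (Fin (2 * n)) (Fin (2 * n)) ℝ :=
  Matrix.of fun l m =>
    (((U : Op n) * majorana l * (U : Op n).conjTranspose * majorana m
      + majorana m * ((U : Op n) * majorana l * (U : Op n).conjTranspose)) 0 0).re / 2

theorem ActsBy.eq_rotationMatrix {U : QubitUnitary n} {R : Matrix (Fin (2 * n)) (Fin (2 * n)) ℝ}
    (h : ActsBy U R) : R = rotationMatrix U := by
  ext l m
  rw [rotationMatrix, Matrix.of_apply, h.conj_majorana, majoranaSum_anticommutator]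
  simp

theorem actsBy_rotationMatrix {U : QubitUnitary n} (hU : U ∈ rotationGroup n) :
    ActsBy U (rotationMatrix U) := by
  obtain ⟨R, -, h⟩ := mem_rotationGroup.1 hU
  rwa [← h.eq_rotationMatrix]

theorem det_rotationMatrix {U : QubitUnitary n} (hU : U ∈ rotationGroup n) :
    (rotationMatrix U).det = 1 := by
  obtain ⟨R, h, hdet⟩ := actsAsProperRotation_iff.1 hU
  rwa [← h.eq_rotationMatrix]

theorem continuous_rotationMatrix : Continuous (rotationMatrix (n := n)) := by
  refine continuous_matrix fun l m => ?_
  have hU : Continuous fun U : QubitUnitary n => (U : Op n) := continuous_subtype_val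
  have h : Continuous fun U : QubitUnitary n =>
      (U : Op n) * majorana l * (U : Op n).conjTranspose :=
    (hU.mul continuous_const).mul hU.matrix_conjTranspose
  exact (Complex.continuous_re.comp (((h.mul continuous_const).add
    (continuous_const.mul h)).matrix_elem 0 0)).div_const 2

/-- The existential over `R` is removed by the explicit continuous candidate `rotationMatrix`, which
leaves equations between continuous functions. -/
theorem isClosed_rotationGroup : IsClosed (rotationGroup n : Set (QubitUnitary n)) := by
  have : (rotationGroup n : Set (QubitUnitary n)) =
      {U : QubitUnitary n | ∀ l, (U : Op n) * majorana l * (U : Op n).conjTranspose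
        = ∑ m, (rotationMatrix U l m : ℂ) • majorana m} ∩ {U : QubitUnitary n | (rotationMatrix U).det = 1} := by
    ext U
    constructor
    · exact fun hU => ⟨actsBy_rotationMatrix hU, det_rotationMatrix hU⟩
    · rintro ⟨h, hdet⟩
      exact actsAsProperRotation_iff.2 ⟨_, h, hdet⟩
  rw [this]
  have hU : Continuous fun U : QubitUnitary n => (U : Op n) := continuous_subtype_val
  refine IsClosed.inter ?_ (isClosed_eq continuous_rotationMatrix.matrix_det continuous_const)
  rw [Set.ofPred_forall]
  refine isClosed_iInter fun l => isClosed_eq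
    ((hU.mul continuous_const).mul hU.matrix_conjTranspose) ?_
  exact continuous_finsetSum _ fun m _ => (Complex.continuous_ofReal.comp
    (continuous_rotationMatrix.matrix_elem l m)).smul continuous_const

theorem isClosed_realGroup : IsClosed (realGroup n : Set (QubitUnitary n)) := by
  have hU : Continuous fun U : QubitUnitary n => (U : Op n) := continuous_subtype_val
  exact isClosed_eq (hU.mul continuous_const)
    (continuous_const.mul (hU.matrix_map Complex.continuous_conj))

variable (n) in
/-- The action on the span of the Majorana operators, as a representation of the group of all
unitaries acting as proper rotations. -/
noncomputable def rotationHom :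
    rotationGroup n →* Matrix.specialOrthogonalGroup (Fin (2 * n)) ℝ where
  -- The transpose undoes the order reversal of `ActsBy.mul`.
  toFun U := ⟨(rotationMatrix (U : QubitUnitary n)).transpose, by
    rw [Matrix.mem_specialOrthogonalGroup_iff, Matrix.mem_orthogonalGroup_iff,
      Matrix.transpose_transpose, Matrix.det_transpose]
    exact ⟨mul_eq_one_comm.1 (actsBy_rotationMatrix U.2).mul_transpose, det_rotationMatrix U.2⟩⟩
  map_one' := Subtype.ext (by
    change (rotationMatrix 1).transpose = 1
    rw [← actsBy_one.eq_rotationMatrix, Matrix.transpose_one])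
  map_mul' U V := Subtype.ext (by
    change (rotationMatrix (U * V : QubitUnitary n)).transpose
      = (rotationMatrix (U : QubitUnitary n)).transpose
        * (rotationMatrix (V : QubitUnitary n)).transpose
    rw [← ((actsBy_rotationMatrix U.2).mul (actsBy_rotationMatrix V.2)).eq_rotationMatrix,
      Matrix.transpose_mul])

theorem continuous_rotationHom : Continuous (rotationHom n) :=
  Continuous.subtype_mk
    (continuous_rotationMatrix.comp continuous_subtype_val).matrix_transpose _

/-- Containing the Givens gates makes the action surjective, the trivial commutant makes its kernel
the phases, and closedness gives the compactness that makes the inverse continuous. -/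
theorem isRotationGroupModPhases_of_closed (hn : 1 ≤ n) {H : Subgroup (QubitUnitary n)}
    (hH : H ≤ rotationGroup n) (hG : Subgroup.closure (givensGates n) ≤ H)
    (hclosed : IsClosed (H : Set (QubitUnitary n))) : IsRotationGroupModPhases H := by
  have : CompactSpace H := isCompact_iff_compactSpace.1 hclosed.isCompact
  let φ : H →* Matrix.specialOrthogonalGroup (Fin (2 * n)) ℝ :=
    (rotationHom n).comp (Subgroup.inclusion hH)
  have hφ : ∀ U : H, ((φ U : Matrix (Fin (2 * n)) (Fin (2 * n)) ℝ)).transpose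
      = rotationMatrix (U : QubitUnitary n) := fun U => Matrix.transpose_transpose _
  have hsurj : Function.Surjective φ := by
    rintro ⟨R, hR⟩
    obtain ⟨V, hV, hVR⟩ := exists_product_actsBy hn
      (R := R.transpose) (by
        rw [Matrix.mem_specialOrthogonalGroup_iff, Matrix.mem_orthogonalGroup_iff] at hR ⊢
        rw [Matrix.transpose_transpose, Matrix.det_transpose]
        exact ⟨mul_eq_one_comm.1 hR.1, hR.2⟩)
    refine ⟨⟨V, hG hV.mem_closure⟩, Subtype.ext (Matrix.transpose_injective ?_)⟩
    rw [hφ]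
    exact hVR.eq_rotationMatrix.symm
  have hker : (phases n).subgroupOf H = φ.ker := by
    ext U
    have hU := actsBy_rotationMatrix (hH U.2)
    rw [Subgroup.mem_subgroupOf, MonoidHom.mem_ker]
    constructor
    · rintro ⟨z, hz⟩
      refine Subtype.ext (Matrix.transpose_injective ?_)
      rw [hφ, ← (ActsBy.of_smul (V := 1) hz actsBy_one).eq_rotationMatrix]
      exact Matrix.transpose_one.symm
    · intro h
      rw [← hφ, h] at hU
      exact exists_eq_smul_one_of_actsBy_one (by simpa using hU)
  let e := QuotientGroup.liftEquiv ((phases n).subgroupOf H) hsurj hker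
  have he : Continuous e := by
    refine (QuotientGroup.isQuotientMap_mk _).continuous_iff.2 ?_
    exact continuous_rotationHom.comp (continuous_inclusion hH)
  refine ⟨{ e with
    continuous_toFun := he
    continuous_invFun := Continuous.continuous_symm_of_equiv_compact_to_t2 (f := e.toEquiv) he },
    fun U => ?_⟩
  change ActsBy (U : QubitUnitary n) ((φ U : Matrix (Fin (2 * n)) (Fin (2 * n)) ℝ)).transpose
  rw [hφ]
  exact actsBy_rotationMatrix (hH U.2)

end Topology

end Matchgate

/-! ### The main theorem. -/

theorem mainTheorem5 (n : ℕ) (hn : 2 ≤ n) :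
    -- every element of the matchgate group acts as a proper rotation
    (∀ U ∈ Matchgate.matchgateGroup n, Matchgate.ActsAsProperRotation U) ∧
    -- every unitary that acts as a proper rotation is a short product of matchgates
    (∀ U : Matchgate.QubitUnitary n, Matchgate.ActsAsProperRotation U →
      U ∈ Matchgate.matchgateGroup n ∧
      Matchgate.IsProductOfAtMost (Matchgate.nnMatchgates n) (2 * n ^ 3) U) ∧
    -- the same with the normalisation `det A = det B = 1`, up to one global phase
    (∀ U : Matchgate.QubitUnitary n, Matchgate.ActsAsProperRotation U →
      ∃ z : ℂ, ‖z‖ = 1 ∧ ∃ V ∈ Matchgate.specialMatchgateGroup n,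
        Matchgate.IsProductOfAtMost (Matchgate.nnSpecialMatchgates n) (2 * n ^ 3) V ∧
        (U : Matchgate.Op n) = z • (V : Matchgate.Op n)) ∧
    (∀ U ∈ Matchgate.specialMatchgateGroup n,
      Matchgate.IsProductOfAtMost (Matchgate.nnSpecialMatchgates n) (2 * n ^ 3) U) ∧
    -- the only phases in the normalised group are the two signs
    (∀ U : Matchgate.QubitUnitary n,
      U ∈ Matchgate.specialMatchgateGroup n ⊓ Matchgate.phases n ↔
        (U : Matchgate.Op n) = 1 ∨ (U : Matchgate.Op n) = -1) ∧
    -- up to global phases, both groups are `SO(2n)`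
    Matchgate.IsRotationGroupModPhases (Matchgate.matchgateGroup n) ∧
    Matchgate.IsRotationGroupModPhases (Matchgate.specialMatchgateGroup n) ∧
    -- both groups are compact
    CompactSpace (Matchgate.matchgateGroup n) ∧
    CompactSpace (Matchgate.specialMatchgateGroup n) := by
  open Matchgate in
  have hGs := givensGates_subset_nnSpecialMatchgates hn
  have hclosed : IsClosed (specialMatchgateGroup n : Set (QubitUnitary n)) := by
    rw [specialMatchgateGroup_eq hn]
    exact isClosed_rotationGroup.inter isClosed_realGroup
  refine ⟨fun U hU => ?_, fun U hU => ⟨?_, ?_⟩, fun U hU => ?_, fun U hU => ?_, fun U => ?_, ?_,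
    ?_, ?_, ?_⟩
  · rw [matchgateGroup_eq hn] at hU
    exact hU
  · rw [matchgateGroup_eq hn]
    exact hU
  · exact isProductOfAtMost_of_mem_rotationGroup hn hU
  · obtain ⟨z, V, hV, hz⟩ := exists_smul_product_of_mem_rotationGroup (by omega) hU
    have hV' := hV.mono hGs ((Nat.le_succ _).trans (length_bound hn))
    refine ⟨z, ?_, V, hV'.mem_closure, hV', hz⟩
    have h := norm_eq_one_of_smul hz
    rw [Complex.star_def, Complex.mul_conj'] at h
    exact (pow_eq_one_iff_of_nonneg (norm_nonneg _) two_ne_zero).1 (by exact_mod_cast h)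
  · rw [specialMatchgateGroup_eq hn] at hU
    exact (isProductOfAtMost_of_mem_rotationGroup_of_mem_realGroup (by omega) hU.1 hU.2).mono hGs
      (length_bound hn)
  · constructor
    · rintro ⟨hU, z, hz⟩
      rw [SetLike.mem_coe, specialMatchgateGroup_eq hn] at hU
      rcases eq_one_or_neg_one_of_mem_realGroup hU.2 hz with h | h
      · exact Or.inl (by rw [hz, h, one_smul])
      · exact Or.inr (by rw [hz, h, neg_one_smul])
    · rintro (h | h)
      · rw [show U = 1 from Subtype.ext h]
        exact one_mem _
      · obtain ⟨W, hW, eW⟩ := neg_one_mem_givensGates (n := n) (by omega)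
        refine ⟨?_, -1, by rw [h, neg_one_smul]⟩
        rw [show U = W from Subtype.ext (by rw [h, eW, neg_one_smul])]
        exact Subgroup.subset_closure (hGs hW)
  · rw [matchgateGroup_eq hn]
    exact isRotationGroupModPhases_of_closed (by omega) le_rfl
      closure_givensGates_le_rotationGroup isClosed_rotationGroup
  · refine isRotationGroupModPhases_of_closed (by omega) ?_ ?_ hclosed
    · rw [specialMatchgateGroup_eq hn]
      exact inf_le_left
    · rw [specialMatchgateGroup_eq_closure_givensGates hn]
  · rw [matchgateGroup_eq hn]
    exact isCompact_iff_compactSpace.1 isClosed_rotationGroup.isCompact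
  · exact isCompact_iff_compactSpace.1 hclosed.isCompact
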